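/- Let $n\ge 1$ and $0<\theta\le 1$. For $m>0$ let $L_\theta=\log(I+(-\Delta)^\theta)$ be the Fourier multiplier operator on $L^2(\mathbf R^n)$ with symbol $\log(1+|\xi|^{2\theta})$, where $\hat f(\xi)=\int_{\mathbf R^n}e^{-ix\cdot\xi}f(x)\,dx$, and consider the Cauchy problem $$u_{tt}-\Delta u+m^2L_\theta u-\Delta u_t=0\quad(t>0),\qquad u(0)=0,\quad u_t(0)=u_1 .$$ Its mild solution is the function $u\in C([0,\infty);H^1(\mathbf R^n))\cap C^1([0,\infty);L^2(\mathbf R^n))$ for which $U=(u,u_t)$ satisfies $\int_0^tU(s)\,ds\in D(A)$ and $U(t)=(0,u_1)+A\int_0^tU(s)\,ds$ for all $t\ge0$, where $A(f,g)=(g,\Delta(f+g)-m^2L_\theta f)$ on $D(A)=\{(f,g)\in H^1\times H^1: f+g\in H^2\}$. Let $u_1\in L^2(\mathbf R^n)\cap L^{1,\theta}(\mathbf R^n)$ (real or complex valued), that is, $u_1\in L^2$ and $\|u_1\|_{1,\theta}=\int_{\mathbf R^n}(1+|x|^\theta)|u_1(x)|\,dx<\infty$. Put $P_1=\int_{\mathbf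 R^n}u_1(x)\,dx$ and $$\varphi(t,\xi)=P_1\,e^{-|\xi|^2t/2}\,\frac{\sin\!\big(t\sqrt{|\xi|^2+m^2\log(1+|\xi|^{2\theta})}\big)}{\sqrt{|\xi|^2+m^2\log(1+|\xi|^{2\theta})}} .$$ Then there are constants $C,\alpha,\beta,\gamma>0$ depending only on $n$ and $\theta$ such that, for all $m>0$, all such $u_1$, and the mild solution $u$, $$\begin{aligned}\int_{\mathbf R^n}|\hat u(t,\xi)-\varphi(t,\xi)|^2\,d\xi\le C\Big(&m^{-2}|P_1|^2t^{-\frac{n+8-6\theta}{2}}+m^{-2}|P_1|^2t^{-\frac{n+4-4\theta}{2}}+m^{-2}\|u_1\|_{1,\theta}^2t^{-\frac n2}+|P_1|^2e^{-\gamma t}\\&+\|u_1\|_{2}^2\,t^2e^{-\gamma t}+\|u_1\|_1^2\,t^2e^{-\alpha t}+\|u_1\|_1^2\,t^2e^{-\beta t}\Big)\qquad\text{for all }t>0,\end{aligned}$$ where $\|\cdot\|_q$ is the norm of $L^q(\mathbf R^n)$. Moreover, if $n\le3$ and $t\ge1$, the same bound holds with $\|u_1\|_2^2\,t^2e^{-\gamma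 t}$ replaced by $\|u_1\|_1^2\,t^2e^{-\gamma t}$. -/

import Mathlib

noncomputable section

namespace LogWave

open MeasureTheory Set
open scoped FourierTransform Laplacian SchwartzMap

/-- The physical (and frequency) space `ℝⁿ`. -/
abbrev Space (n : ℕ) : Type := EuclideanSpace ℝ (Fin n)

/-- The complex Hilbert space `L²(ℝⁿ)`. -/
abbrev L2 (n : ℕ) : Type := Lp (α := Space n) ℂ 2 volume

variable {n : ℕ}

/-- The (Plancherel) Fourier transform of `f ∈ L²(ℝⁿ)` in the normalization
`f̂(ξ) = ∫ exp(-i x·ξ) f(x) dx`. Mathlib's transform `𝓕` has the kernel `exp(-2πi x·ξ)`, so that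
`f̂(ξ) = (𝓕 f)(ξ / (2π))`. -/
def hat (f : L2 n) (ξ : Space n) : ℂ :=
  (𝓕 f : L2 n) ((2 * Real.pi)⁻¹ • ξ)

/-- The symbol `log(1 + |ξ|^(2θ))` of `log(I + (-Δ)^θ)`. -/
def logSymbol (θ : ℝ) (ξ : Space n) : ℝ :=
  Real.log (1 + ‖ξ‖ ^ (2 * θ))

/-- `f ∈ D(L_θ)`: the function `log(1 + |ξ|^(2θ)) f̂(ξ)` is square integrable. It is written in the
frequency variable `x = ξ / (2π)` of Mathlib's transform. -/
def InLogLaplacianDomain (θ : ℝ) (f : L2 n) : Prop :=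
  MemLp (fun x : Space n => (logSymbol θ ((2 * Real.pi) • x) : ℂ) * (𝓕 f : L2 n) x) 2 volume

/-- The operator `L_θ = log(I + (-Δ)^θ)` on its domain: the Fourier multiplier with symbol
`log(1 + |ξ|^(2θ))`. -/
def logLaplacian (θ : ℝ) (f : L2 n) (hf : InLogLaplacianDomain θ f) : L2 n :=
  𝓕⁻ (MemLp.toLp _ hf)

/-- `f ∈ L²(ℝⁿ)` belongs to the Sobolev space `H^s(ℝⁿ)`. -/
def InH (s : ℝ) (f : L2 n) : Prop :=
  TemperedDistribution.MemSobolev s 2 (f : 𝓢'(Space n, ℂ))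

/-- `u ∈ C([0,∞); H¹(ℝⁿ))`: Mathlib's Bessel potential of order one, which is an isomorphism
of `H¹` onto `L²`, maps `u` to a continuous function with values in `L²`. -/
def ContinuousInH1 (u : ℝ → L2 n) : Prop :=
  ∃ w : ℝ → L2 n, ContinuousOn w (Ici 0) ∧ ∀ t, 0 ≤ t →
    TemperedDistribution.besselPotential (Space n) ℂ 1 (u t : 𝓢'(Space n, ℂ)) =
      (w t : 𝓢'(Space n, ℂ))

/-- The graph of the generator on `X = H¹ × L²` of the first order system for `(u, u_t)`.
The domain consists of the pairs `(f, g) ∈ H¹ × H¹` with `f + g ∈ H²`, and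
`(f, g)` is mapped to `(g, Δ(f + g) - m² L_θ f)`; `SecondComponent θ m f g h` says that `(f, g)`
is in the domain and that the second component of its image is `h`. Here `Δ` is the
distributional Laplacian, and `L_θ f` makes sense because `H¹` is contained in `D(L_θ)`. -/
def SecondComponent (θ m : ℝ) (f g h : L2 n) : Prop :=
  InH 1 f ∧ InH 1 g ∧ InH 2 (f + g) ∧
    ∃ (w : L2 n) (hf : InLogLaplacianDomain θ f),
      Δ ((f + g : L2 n) : 𝓢'(Space n, ℂ)) = (w : 𝓢'(Space n, ℂ)) ∧
      h = w - m ^ 2 • logLaplacian θ f hf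

/-- `u`, with time derivative `v = u_t`, is the mild solution of
`u_tt - Δu + m² L_θ u - Δu_t = 0`, `u(0) = u₀`, `u_t(0) = u₁`: it lies in
`C([0,∞); H¹) ∩ C¹([0,∞); L²)`, and `U = (u, u_t)` satisfies the integrated equation
`∫₀ᵗ U ∈ D(A)`, `U(t) = U(0) + A ∫₀ᵗ U` for all `t ≥ 0`, where `A` is the generator above.
(The first component of this equation says that `u_t = v` and `u(0) = u₀`.) -/
structure IsMildSolution (θ m : ℝ) (u₀ u₁ : L2 n) (u v : ℝ → L2 n) : Prop where
  continuous_H1 : ContinuousInH1 u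
  hasDeriv : ∀ t, 0 ≤ t → HasDerivWithinAt u (v t) (Ici 0) t
  continuous_deriv : ContinuousOn v (Ici 0)
  init : u 0 = u₀
  init_deriv : v 0 = u₁
  equation : ∀ t, 0 ≤ t →
    SecondComponent θ m (∫ s in (0 : ℝ)..t, u s) (∫ s in (0 : ℝ)..t, v s) (v t - u₁)

/-- `f ∈ L^{1,θ}(ℝⁿ)`. -/
def InWeightedL1 (θ : ℝ) (f : L2 n) : Prop :=
  Integrable (fun x => f x) volume ∧
    Integrable (fun x : Space n => (1 + ‖x‖ ^ θ) * ‖f x‖) volume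

/-- `‖f‖_{1,θ} = ∫ (1 + |x|^θ) |f(x)| dx`. -/
def weightedL1Norm (θ : ℝ) (f : L2 n) : ℝ :=
  ∫ x : Space n, (1 + ‖x‖ ^ θ) * ‖f x‖

/-- `‖f‖₁ = ∫ |f(x)| dx`. -/
def L1Norm (f : L2 n) : ℝ :=
  ∫ x : Space n, ‖f x‖

/-- The moment `P₁ = ∫ u₁(x) dx`. -/
def moment (u₁ : L2 n) : ℂ :=
  ∫ x : Space n, u₁ x

/-- `√(|ξ|² + m² log(1 + |ξ|^(2θ)))`. -/
def omega (θ m : ℝ) (ξ : Space n) : ℝ :=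
  Real.sqrt (‖ξ‖ ^ 2 + m ^ 2 * logSymbol θ ξ)

/-- The asymptotic profile `φ(t, ξ)`. -/
def profile (θ m : ℝ) (u₁ : L2 n) (t : ℝ) (ξ : Space n) : ℂ :=
  moment u₁ *
    ((Real.exp (-(‖ξ‖ ^ 2 / 2) * t) * (Real.sin (t * omega θ m ξ) / omega θ m ξ) : ℝ) : ℂ)

/-- The squared `L²` distance `∫ |û(t, ξ) - φ(t, ξ)|² dξ`, as an element of `[0, ∞]`. -/
def errorSq (θ m : ℝ) (u₁ : L2 n) (u : ℝ → L2 n) (t : ℝ) : ENNReal :=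
  ∫⁻ ξ : Space n, ‖hat (u t) ξ - profile θ m u₁ t ξ‖ₑ ^ 2

/-- The sum of the decaying terms. The number `N` is the norm of `u₁` which is used in the
term `t² exp(-γ t)`. -/
def decayTerms (θ m α β γ : ℝ) (u₁ : L2 n) (N t : ℝ) : ℝ :=
  (m ^ 2)⁻¹ * ‖moment u₁‖ ^ 2 * t ^ (-((n + 8 - 6 * θ) / 2))
    + (m ^ 2)⁻¹ * ‖moment u₁‖ ^ 2 * t ^ (-((n + 4 - 4 * θ) / 2))
    + (m ^ 2)⁻¹ * weightedL1Norm θ u₁ ^ 2 * t ^ (-((n : ℝ) / 2))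
    + ‖moment u₁‖ ^ 2 * Real.exp (-γ * t)
    + N ^ 2 * t ^ 2 * Real.exp (-γ * t)
    + L1Norm u₁ ^ 2 * t ^ 2 * Real.exp (-α * t)
    + L1Norm u₁ ^ 2 * t ^ 2 * Real.exp (-β * t)

end LogWave

end

/-!
On the Fourier side the equation is, for each frequency `ξ`, the damped oscillator
`y'' + |ξ|² y' + ω(ξ)² y = 0` with `ω(ξ)² = |ξ|² + m² log(1 + |ξ|^(2θ))`, whose characteristic roots
are `-|ξ|²/2 ± √(disc ξ)` with `disc ξ = |ξ|⁴/4 - ω(ξ)²`. Hence `û(t) = K(t) û₁` with an explicit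
kernel `K` (`IsMildSolution.hat_eq`). To deduce this from the integrated equation, the
transformed equation is multiplied by the indicator of a ball, which makes all multipliers bounded
operators on `L²`. If `a` and `b` are the two roots, `û_t - b û` then solves `p' = a p`, so that it
is `exp (t a) û₁` (`IsMildSolution.fourier_deriv_sub`). Subtracting the identities for the two
orders of the roots gives `û` wherever the roots differ, that is, off a null set
(`ae_disc_ne_zero`).

The error is estimated separately for low and high frequencies.

* For `|ξ| ≤ 1` the kernel is `exp(-|ξ|² t/2) sin(tb)/b` with `b ≥ m |ξ|^θ / 2`. This loss is
  compensated by `|û₁(ξ) - P₁| ≤ 2 |ξ|^θ ‖u₁‖_{1,θ}` (`norm_hat_sub_moment_le`). Replacing `b` by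
  `ω` costs only `O(m⁻¹ exp(-|ξ|² t/4))` (`norm_kernel_sub_le`). Both contributions integrate to
  `m⁻² ‖u₁‖²_{1,θ} t^(-n/2)`.
* For `|ξ| > 1` the profile is at most `√2 m⁻¹ |P₁| exp(-|ξ|² t/2)`, with the same integral, and the
  solution itself is exponentially small. Indeed both roots have real part at most `-1/2`, because
  `ω(ξ) ≥ |ξ|`. This gives `|K|² ≤ t² exp(-t)` and the bound by `‖u₁‖₂` (`norm_kernel_sq_le`).
  Where the roots are real and far apart there is the additional gain `|K| ≤ 2 |ξ|⁻² exp(-t)`. As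
  `|ξ|⁻⁴` is integrable at infinity for `n ≤ 3`, this gives the bound by `‖u₁‖₁`
  (`norm_kernel_sq_le_tailMajorant`).

Since `|P₁| ≤ ‖u₁‖_{1,θ}`, the term `m⁻² ‖u₁‖²_{1,θ} t^(-n/2)` and one term `t² exp(-γ t)` already
dominate the error for all `t` (`le_decayTerms`).
-/

noncomputable section

namespace LogWave

open MeasureTheory Set Filter
open scoped FourierTransform Laplacian SchwartzMap Topology ENNReal ContDiff

variable {n : ℕ}

/-! ### Truncated multiplication operators on `L²` -/

lemma memLp_top_indicator (R : ℝ) (a : C(Space n, ℂ)) :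
    MemLp ((Metric.closedBall (0 : Space n) R).indicator a) ⊤ volume := by
  obtain ⟨C, hC⟩ := (isCompact_closedBall (0 : Space n) R).exists_bound_of_continuousOn
    a.continuous.continuousOn
  refine memLp_top_of_bound
    (a.continuous.aestronglyMeasurable.indicator measurableSet_closedBall) |C|
    (Eventually.of_forall fun x => ?_)
  by_cases hx : x ∈ Metric.closedBall (0 : Space n) R
  · rw [indicator_of_mem hx]
    exact (hC x hx).trans (le_abs_self C)
  · rw [indicator_of_notMem hx]
    simp

/-- The bounded operator on `L²` which multiplies by the continuous function `a` inside the ball of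
radius `R` and by zero outside it. -/
def cutMul (R : ℝ) (a : C(Space n, ℂ)) : L2 n →L[ℂ] L2 n :=
  (ContinuousLinearMap.mul ℂ ℂ).holderL volume ⊤ 2 2 ((memLp_top_indicator R a).toLp _)

lemma coeFn_cutMul (R : ℝ) (a : C(Space n, ℂ)) (f : L2 n) :
    cutMul R a f =ᵐ[volume] fun x => (Metric.closedBall (0 : Space n) R).indicator a x * f x := by
  have h := (ContinuousLinearMap.mul ℂ ℂ).coeFn_holder (r := 2) ((memLp_top_indicator R a).toLp _) f
  filter_upwards [h, (memLp_top_indicator R a).coeFn_toLp] with x hx hx'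
  rw [cutMul, ContinuousLinearMap.holderL_apply_apply, hx, hx']
  rfl

lemma ae_cutMul_apply (R : ℝ) (a : C(Space n, ℂ)) (f : L2 n) :
    ∀ᵐ x, (‖x‖ ≤ R → cutMul R a f x = a x * f x) ∧ (¬ ‖x‖ ≤ R → cutMul R a f x = 0) := by
  filter_upwards [coeFn_cutMul R a f] with x hx
  refine ⟨fun h => ?_, fun h => ?_⟩
  · rw [hx, indicator_of_mem (by simpa using h)]
  · rw [hx, indicator_of_notMem (by simpa using h), zero_mul]

lemma cutMul_cutMul (R : ℝ) (a b : C(Space n, ℂ)) (f : L2 n) :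
    cutMul R a (cutMul R b f) = cutMul R (a * b) f := by
  refine Lp.ext ?_
  filter_upwards [ae_cutMul_apply R a (cutMul R b f), ae_cutMul_apply R b f,
    ae_cutMul_apply R (a * b) f] with x h1 h2 h3
  by_cases hx : ‖x‖ ≤ R
  · rw [h1.1 hx, h2.1 hx, h3.1 hx, ContinuousMap.mul_apply, mul_assoc]
  · rw [h1.2 hx, h3.2 hx]

lemma cutMul_add (R : ℝ) (a b : C(Space n, ℂ)) (f : L2 n) :
    cutMul R (a + b) f = cutMul R a f + cutMul R b f := by
  refine Lp.ext ?_
  filter_upwards [ae_cutMul_apply R a f, ae_cutMul_apply R b f,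
    ae_cutMul_apply R (a + b) f, Lp.coeFn_add (cutMul R a f) (cutMul R b f)]
    with x h1 h2 h3 h4
  rw [h4, Pi.add_apply]
  by_cases hx : ‖x‖ ≤ R
  · rw [h1.1 hx, h2.1 hx, h3.1 hx, ContinuousMap.add_apply, add_mul]
  · rw [h1.2 hx, h2.2 hx, h3.2 hx, add_zero]

lemma cutMul_zero (R : ℝ) (f : L2 n) : cutMul R 0 f = 0 := by
  have h := cutMul_add R 0 0 f
  rwa [add_zero, left_eq_add] at h

lemma cutMul_neg (R : ℝ) (a : C(Space n, ℂ)) (f : L2 n) :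
    cutMul R (-a) f = - cutMul R a f := by
  refine Lp.ext ?_
  filter_upwards [ae_cutMul_apply R a f, ae_cutMul_apply R (-a) f,
    Lp.coeFn_neg (cutMul R a f)] with x h1 h2 h3
  rw [h3, Pi.neg_apply]
  by_cases hx : ‖x‖ ≤ R
  · rw [h1.1 hx, h2.1 hx, ContinuousMap.neg_apply, neg_mul]
  · rw [h1.2 hx, h2.2 hx, neg_zero]

lemma cutMul_smul (R : ℝ) (c : ℂ) (a : C(Space n, ℂ)) (f : L2 n) :
    cutMul R (c • a) f = c • cutMul R a f := by
  refine Lp.ext ?_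
  filter_upwards [ae_cutMul_apply R a f, ae_cutMul_apply R (c • a) f,
    Lp.coeFn_smul c (cutMul R a f)] with x h1 h2 h3
  rw [h3, Pi.smul_apply]
  by_cases hx : ‖x‖ ≤ R
  · rw [h1.1 hx, h2.1 hx, ContinuousMap.smul_apply, smul_mul_assoc]
  · rw [h1.2 hx, h2.2 hx, smul_zero]

lemma cutMul_pow (R : ℝ) (a : C(Space n, ℂ)) (f : L2 n) (k : ℕ) :
    (cutMul R a ^ k) (cutMul R 1 f) = cutMul R (a ^ k) f := by
  induction k with
  | zero => simp
  | succ k ih =>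
    rw [pow_succ', pow_succ' a, ← cutMul_cutMul, ← ih]
    rfl

/-- The exponential of a truncated multiplication operator is multiplication by the exponential.
The partial sums of the exponential series converge in `L²`, hence almost everywhere along a
subsequence. -/
lemma exp_cutMul (R : ℝ) (a : C(Space n, ℂ)) (f : L2 n) :
    ∀ᵐ x, ‖x‖ ≤ R →
      (NormedSpace.exp (cutMul R a) (cutMul R 1 f) : L2 n) x = Complex.exp (a x) * f x := by
  set g : ℕ → L2 n := fun N =>
    (∑ k ∈ Finset.range N, ((k.factorial : ℂ)⁻¹) • (cutMul R a) ^ k) (cutMul R 1 f) with hg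
  have hlim : Tendsto g atTop (𝓝 (NormedSpace.exp (cutMul R a) (cutMul R 1 f))) := by
    have h := (NormedSpace.exp_series_hasSum_exp' (𝕂 := ℂ) (cutMul R a)).tendsto_sum_nat
    exact ((ContinuousLinearMap.apply ℂ (L2 n) (cutMul R 1 f)).continuous.tendsto _).comp h
  obtain ⟨φ, hφ, hae⟩ := (tendstoInMeasure_of_tendsto_Lp hlim).exists_seq_tendsto_ae
  have hgk : ∀ᵐ x, ∀ N : ℕ, ‖x‖ ≤ R →
      g N x = (∑ k ∈ Finset.range N, a x ^ k / (k.factorial : ℂ)) * f x := by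
    rw [ae_all_iff]
    intro N
    have hgN : g N = cutMul R (∑ k ∈ Finset.range N, ((k.factorial : ℂ)⁻¹) • a ^ k) f := by
      simp only [hg]
      induction N with
      | zero =>
        rw [Finset.sum_range_zero, Finset.sum_range_zero, cutMul_zero]
        rfl
      | succ N ih =>
        rw [Finset.sum_range_succ, Finset.sum_range_succ, cutMul_add, ← ih,
          _root_.add_apply, _root_.smul_apply, cutMul_pow, cutMul_smul]
    rw [hgN]
    filter_upwards [ae_cutMul_apply R
      (∑ k ∈ Finset.range N, ((k.factorial : ℂ)⁻¹) • a ^ k) f] with x hx hR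
    rw [hx.1 hR]
    congr 1
    simp [ContinuousMap.sum_apply, div_eq_inv_mul]
  filter_upwards [hae, hgk] with x hx hxk hR
  refine tendsto_nhds_unique hx ?_
  have h1 : Tendsto (fun N => ∑ k ∈ Finset.range N, a x ^ k / (k.factorial : ℂ)) atTop
      (𝓝 (Complex.exp (a x))) := by
    rw [Complex.exp_eq_exp_ℂ]
    exact (NormedSpace.expSeries_div_hasSum_exp (a x)).tendsto_sum_nat
  have h2 := (h1.comp hφ.tendsto_atTop).mul_const (f x)
  refine h2.congr fun N => ?_
  rw [hxk _ hR]
  rfl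

/-- A solution on `[0,∞)` of the linear equation `p' = L p` is `exp (t L) p(0)`. -/
lemma eq_exp_of_hasDerivWithinAt {E : Type*} [NormedAddCommGroup E] [NormedSpace ℂ E]
    [CompleteSpace E] (L : E →L[ℂ] E) (p : ℝ → E)
    (hp : ∀ t, 0 ≤ t → HasDerivWithinAt p (L (p t)) (Ici 0) t) (t : ℝ) (ht : 0 ≤ t) :
    p t = NormedSpace.exp ((t : ℂ) • L) (p 0) := by
  have hd : ∀ s : ℝ, HasDerivAt (fun s : ℝ => NormedSpace.exp ((-s : ℂ) • L))
      (-(NormedSpace.exp ((-s : ℂ) • L) * L)) s := by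
    intro s
    have h := hasDerivAt_exp_smul_const (𝕂 := ℂ) L (-s : ℂ)
    have h' : HasDerivAt (fun s : ℝ => (-s : ℂ)) (-1) s :=
      (Complex.ofRealCLM.hasDerivAt (x := s)).neg
    have h2 := h.scomp (𝕜 := ℝ) s h'
    simpa [Function.comp_def] using h2
  have hq : ∀ s, 0 ≤ s →
      HasDerivWithinAt (fun s : ℝ => (NormedSpace.exp ((-s : ℂ) • L)) (p s)) 0 (Ici 0) s := by
    intro s hs
    have h := (ContinuousLinearMap.restrictScalarsL ℂ E E ℝ ℝ).hasDerivWithinAt_of_bilinear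
      (hd s).hasDerivWithinAt (hp s hs)
    simpa using h
  have hc := constant_of_has_deriv_right_zero (a := 0) (b := t)
    (f := fun s : ℝ => (NormedSpace.exp ((-s : ℂ) • L)) (p s))
    (fun s hs => ((hq s hs.1).continuousWithinAt).mono Icc_subset_Ici_self)
    (fun s hs => (hq s hs.1).mono (Ici_subset_Ici.2 hs.1)) t ⟨ht, le_rfl⟩
  have hinv : NormedSpace.exp ((t : ℂ) • L) * NormedSpace.exp ((-t : ℂ) • L) = 1 := by
    rw [← NormedSpace.exp_add_of_commute_of_mem_ball (𝕂 := ℂ)]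
    · simp
    · exact ((Commute.refl L).smul_left _).smul_right _
    · simp [NormedSpace.expSeries_radius_eq_top]
    · simp [NormedSpace.expSeries_radius_eq_top]
  have h1 := congrArg (NormedSpace.exp ((t : ℂ) • L) : E →L[ℂ] E) hc
  simp only [Complex.ofReal_zero, neg_zero, zero_smul, NormedSpace.exp_zero] at h1
  calc p t = (NormedSpace.exp ((t : ℂ) • L) * NormedSpace.exp ((-t : ℂ) • L)) (p t) := by
        rw [hinv]; rfl
    _ = _ := h1

/-! ### The Fourier transform on `L²` -/

/-- Locally integrable functions with the same integrals against Schwartz functions agree. -/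
lemma ae_eq_of_integral_schwartz {f g : Space n → ℂ} (hf : LocallyIntegrable f volume)
    (hg : LocallyIntegrable g volume)
    (h : ∀ φ : 𝓢(Space n, ℂ), ∫ x, φ x * f x = ∫ x, φ x * g x) : f =ᵐ[volume] g := by
  refine ae_eq_of_integral_contDiff_smul_eq hf hg fun φ hφ hc => ?_
  have hg₁ : HasCompactSupport (Complex.ofRealCLM ∘ φ) := hc.comp_left rfl
  have hg₂ : ContDiff ℝ ∞ (Complex.ofRealCLM ∘ φ) := by fun_prop
  have h' := h (hg₁.toSchwartzMap hg₂)
  simpa using h'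

/-- On `L¹ ∩ L²` the `L²` Fourier transform is given by the Fourier integral. -/
lemma fourier_ae_eq_integral (f : L2 n) (hf : Integrable (fun x => f x) volume) :
    (𝓕 f : L2 n) =ᵐ[volume] 𝓕 (fun x => f x) := by
  refine ae_eq_of_integral_schwartz ((Lp.memLp _).locallyIntegrable one_le_two) ?_ fun φ => ?_
  · exact (VectorFourier.fourierIntegral_continuous Real.continuous_fourierChar
      continuous_inner hf).locallyIntegrable
  · have h1 := congrArg (fun T : 𝓢'(Space n, ℂ) => T φ) (Lp.fourier_toTemperedDistribution_eq f)
    simp only [TemperedDistribution.fourier_apply, Lp.toTemperedDistribution_apply,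
      smul_eq_mul] at h1
    rw [← h1]
    have h2 := VectorFourier.integral_fourierIntegral_smul_eq_flip (L := innerₗ (Space n))
      (μ := volume) (ν := volume) (f := φ) (g := fun x => f x)
      Real.continuous_fourierChar continuous_inner φ.integrable hf
    simp only [flip_innerₗ, smul_eq_mul] at h2
    exact h2

/-- If the distributional Laplacian of `f` is the `L²` function `w`, then
`ŵ = -(2π|x|)² f̂` almost everywhere. -/
lemma fourier_ae_eq_of_laplacian_eq (f w : L2 n)
    (h : Δ (f : 𝓢'(Space n, ℂ)) = (w : 𝓢'(Space n, ℂ))) :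
    (𝓕 w : L2 n) =ᵐ[volume]
      fun x => -(((2 * Real.pi * ‖x‖) ^ 2 : ℝ) : ℂ) * (𝓕 f : L2 n) x := by
  have hc : Continuous fun x : Space n => -(((2 * Real.pi * ‖x‖) ^ 2 : ℝ) : ℂ) := by fun_prop
  have htg : (fun x : Space n => Complex.ofReal (‖x‖ ^ 2)).HasTemperateGrowth := by fun_prop
  refine ae_eq_of_integral_schwartz ((Lp.memLp _).locallyIntegrable one_le_two) ?_ fun φ => ?_
  · rw [← locallyIntegrableOn_univ]
    exact ((Lp.memLp (𝓕 f)).locallyIntegrable one_le_two).locallyIntegrableOn univ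
      |>.continuousOn_mul hc.continuousOn isOpen_univ.isLocallyClosed
  · rw [TemperedDistribution.laplacian_eq_fourierMultiplierCLM,
      TemperedDistribution.fourierMultiplierCLM_apply, ← Complex.coe_smul] at h
    have h1 := congrArg (fun T : 𝓢'(Space n, ℂ) => 𝓕 T φ) h
    simp only [FourierTransform.fourier_smul, FourierTransform.fourier_fourierInv_eq,
      Lp.fourier_toTemperedDistribution_eq] at h1
    have h2 : (TemperedDistribution.smulLeftCLM ℂ (fun x : Space n => Complex.ofReal (‖x‖ ^ 2))
      ((𝓕 f : L2 n) : 𝓢'(Space n, ℂ))) φ = ∫ x, φ x * (((‖x‖ ^ 2 : ℝ) : ℂ) * (𝓕 f : L2 n) x) := by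
      rw [TemperedDistribution.smulLeftCLM_apply_apply, Lp.toTemperedDistribution_apply]
      refine integral_congr_ae (Eventually.of_forall fun x => ?_)
      simp only [SchwartzMap.smulLeftCLM_apply_apply htg, smul_eq_mul]
      ring
    have h3 : (((-(2 * Real.pi) ^ 2 : ℝ) : ℂ) •
        TemperedDistribution.smulLeftCLM ℂ (fun x : Space n => Complex.ofReal (‖x‖ ^ 2))
          ((𝓕 f : L2 n) : 𝓢'(Space n, ℂ))) φ = ((𝓕 w : L2 n) : 𝓢'(Space n, ℂ)) φ := h1
    rw [_root_.smul_apply, h2, Lp.toTemperedDistribution_apply, smul_eq_mul] at h3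
    simp only [smul_eq_mul] at h3
    rw [← h3, ← integral_const_mul]
    refine integral_congr_ae (Eventually.of_forall fun x => ?_)
    push_cast
    ring

/-- The Fourier transform of `L_θ f` is `log(1 + |ξ|^(2θ)) f̂`. -/
lemma fourier_logLaplacian (θ : ℝ) (f : L2 n) (hf : InLogLaplacianDomain θ f) :
    (𝓕 (logLaplacian θ f hf) : L2 n) =ᵐ[volume]
      fun x => (logSymbol θ ((2 * Real.pi) • x) : ℂ) * (𝓕 f : L2 n) x := by
  rw [logLaplacian, FourierTransform.fourier_fourierInv_eq]
  exact hf.coeFn_toLp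

/-! ### The characteristic roots -/

lemma logSymbol_nonneg (θ : ℝ) (ξ : Space n) : 0 ≤ logSymbol θ ξ :=
  Real.log_nonneg (le_add_of_nonneg_right (Real.rpow_nonneg (norm_nonneg _) _))

lemma continuous_logSymbol {θ : ℝ} (hθ : 0 < θ) : Continuous (logSymbol θ : Space n → ℝ) := by
  refine Continuous.log (continuous_const.add
    (continuous_norm.rpow_const fun _ => Or.inr (by positivity))) fun ξ => ?_
  have := Real.rpow_nonneg (norm_nonneg ξ) (2 * θ)
  positivity

lemma omega_sq (θ m : ℝ) (ξ : Space n) :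
    omega θ m ξ ^ 2 = ‖ξ‖ ^ 2 + m ^ 2 * logSymbol θ ξ :=
  Real.sq_sqrt (by have := logSymbol_nonneg θ ξ; positivity)

lemma continuous_omega {θ : ℝ} (hθ : 0 < θ) (m : ℝ) :
    Continuous (omega θ m : Space n → ℝ) := by
  have := continuous_logSymbol (n := n) hθ
  unfold omega
  fun_prop

/-- The discriminant `|ξ|⁴/4 - ω(ξ)²` of the characteristic polynomial
`λ² + |ξ|² λ + ω(ξ)²`. -/
def disc (θ m : ℝ) (ξ : Space n) : ℝ := ‖ξ‖ ^ 4 / 4 - omega θ m ξ ^ 2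

/-- A square root of the discriminant: real where `disc ≥ 0`, purely imaginary where
`disc ≤ 0`. -/
def sqrtDisc (θ m : ℝ) (ξ : Space n) : ℂ :=
  (Real.sqrt (disc θ m ξ) : ℂ) + (Real.sqrt (-disc θ m ξ) : ℂ) * Complex.I

lemma sqrtDisc_sq (θ m : ℝ) (ξ : Space n) :
    sqrtDisc θ m ξ ^ 2 = (disc θ m ξ : ℂ) := by
  unfold sqrtDisc
  rcases le_total 0 (disc θ m ξ) with h | h
  · rw [Real.sqrt_eq_zero_of_nonpos (neg_nonpos.2 h)]
    simp only [Complex.ofReal_zero, zero_mul, add_zero]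
    rw [← Complex.ofReal_pow, Real.sq_sqrt h]
  · rw [Real.sqrt_eq_zero_of_nonpos h]
    simp only [Complex.ofReal_zero, zero_add]
    rw [mul_pow, ← Complex.ofReal_pow, Real.sq_sqrt (neg_nonneg.2 h), Complex.I_sq]
    simp

lemma continuous_sqrtDisc {θ : ℝ} (hθ : 0 < θ) (m : ℝ) :
    Continuous (sqrtDisc θ m : Space n → ℂ) := by
  have := continuous_omega (n := n) hθ m
  unfold sqrtDisc disc
  fun_prop

/-- The multiplier `|ξ|²`, in the frequency variable `x = ξ / (2π)`. -/
def lapSymbol : C(Space n, ℂ) :=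
  ⟨fun x => ((‖(2 * Real.pi) • x‖ ^ 2 : ℝ) : ℂ), by fun_prop⟩

/-- The multiplier `log(1 + |ξ|^(2θ))`, in the frequency variable `x = ξ / (2π)`. -/
def logMultiplier {θ : ℝ} (hθ : 0 < θ) : C(Space n, ℂ) :=
  ⟨fun x => (logSymbol θ ((2 * Real.pi) • x) : ℂ), by
    have := continuous_logSymbol (n := n) hθ
    fun_prop⟩

/-- The multiplier `√(disc ξ)`, in the frequency variable `x = ξ / (2π)`. -/
def sqrtDiscMultiplier {θ : ℝ} (hθ : 0 < θ) (m : ℝ) : C(Space n, ℂ) :=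
  ⟨fun x => sqrtDisc θ m ((2 * Real.pi) • x), by
    have := continuous_sqrtDisc (n := n) hθ m
    fun_prop⟩

/-! ### The solution formula in the frequency variable -/

/-- The primitive of a function which is continuous on `[0,∞)` is differentiable on `[0,∞)`. -/
lemma hasDerivWithinAt_primitive {E : Type*} [NormedAddCommGroup E] [NormedSpace ℝ E]
    [CompleteSpace E] {u : ℝ → E} (hu : ContinuousOn u (Ici 0)) {t : ℝ} (ht : 0 ≤ t) :
    HasDerivWithinAt (fun s => ∫ r in (0 : ℝ)..s, u r) (u t) (Ici 0) t := by
  -- Freezing `u` at `u 0` for negative times makes it continuous on the whole line.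
  have hc : Continuous fun s : ℝ => u (max s 0) :=
    hu.comp_continuous (by fun_prop) fun s => mem_Ici.2 (le_max_right s 0)
  have h := (intervalIntegral.integral_hasDerivAt_right (hc.intervalIntegrable 0 t)
    (hc.stronglyMeasurableAtFilter _ _) hc.continuousAt).hasDerivWithinAt (s := Ici 0)
  rw [max_eq_left ht] at h
  have hcongr : ∀ s ∈ Ici (0 : ℝ), (∫ r in (0 : ℝ)..s, u r) = ∫ r in (0 : ℝ)..s, u (max r 0) := by
    intro s hs
    refine intervalIntegral.integral_congr fun r hr => ?_
    rw [uIcc_of_le hs] at hr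
    simp only [max_eq_left hr.1]
  exact h.congr hcongr (hcongr t ht)

/-- Inside a ball, the Fourier transform of the integrated equation expresses `û_t` by `û` and its
primitive. -/
lemma IsMildSolution.cutMul_fourier_deriv {θ m : ℝ} (hθ : 0 < θ) {u₁ : L2 n} {u v : ℝ → L2 n}
    (h : IsMildSolution θ m 0 u₁ u v) (R : ℝ) {t : ℝ} (ht : 0 ≤ t) :
    cutMul R 1 (𝓕 (v t)) = cutMul R 1 (𝓕 u₁) - cutMul R lapSymbol (𝓕 (u t))
      - cutMul R (lapSymbol + (((m ^ 2 : ℝ) : ℂ)) • logMultiplier hθ)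
        (𝓕 (∫ s in (0 : ℝ)..t, u s)) := by
  obtain ⟨-, -, -, w, hf, hw, hv⟩ := h.equation t ht
  have hV : ∫ s in (0 : ℝ)..t, v s = u t := by
    rw [intervalIntegral.integral_eq_sub_of_hasDeriv_right_of_le ht (f := u), h.init, sub_zero]
    · exact fun s hs => (h.hasDeriv s hs.1).continuousWithinAt.mono Icc_subset_Ici_self
    · exact fun s hs => (h.hasDeriv s hs.1.le).mono (Ioi_subset_Ici hs.1.le)
    · refine ContinuousOn.intervalIntegrable (h.continuous_deriv.mono ?_)
      rw [uIcc_of_le ht]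
      exact Icc_subset_Ici_self
  rw [hV] at hw
  set U : L2 n := ∫ s in (0 : ℝ)..t, u s with hU
  have e : (𝓕 (v t) : L2 n) = 𝓕 u₁ + 𝓕 w - ((m ^ 2 : ℝ) : ℂ) • 𝓕 (logLaplacian θ U hf) := by
    have : v t = u₁ + w - ((m ^ 2 : ℝ) : ℂ) • logLaplacian θ U hf := by
      change v t - u₁ = w - m ^ 2 • logLaplacian θ U hf at hv
      rw [eq_sub_iff_add_eq, Complex.coe_smul, ← sub_eq_iff_eq_add', add_sub_right_comm, hv]
      exact sub_add_cancel _ _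
    rw [this]
    simp only [sub_eq_add_neg, ← neg_smul, FourierTransform.fourier_add,
      FourierTransform.fourier_smul]
  have e2 : (𝓕 (U + u t) : L2 n) = 𝓕 U + 𝓕 (u t) := FourierTransform.fourier_add _ _
  refine Lp.ext ?_
  have hA := fourier_ae_eq_of_laplacian_eq _ _ hw
  have hB := fourier_logLaplacian θ U hf
  rw [e2] at hA
  rw [e]
  filter_upwards [hA, hB,
    ae_cutMul_apply R 1 (𝓕 u₁ + 𝓕 w - ((m ^ 2 : ℝ) : ℂ) • 𝓕 (logLaplacian θ U hf)),
    ae_cutMul_apply R 1 (𝓕 u₁), ae_cutMul_apply R lapSymbol (𝓕 (u t)),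
    ae_cutMul_apply R (lapSymbol + (((m ^ 2 : ℝ) : ℂ)) • logMultiplier hθ) (𝓕 U),
    Lp.coeFn_add (𝓕 U) (𝓕 (u t)), Lp.coeFn_add (𝓕 u₁) (𝓕 w),
    Lp.coeFn_sub (𝓕 u₁ + 𝓕 w) (((m ^ 2 : ℝ) : ℂ) • 𝓕 (logLaplacian θ U hf)),
    Lp.coeFn_smul ((m ^ 2 : ℝ) : ℂ) (𝓕 (logLaplacian θ U hf)),
    Lp.coeFn_sub (cutMul R 1 (𝓕 u₁) - cutMul R lapSymbol (𝓕 (u t)))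
      (cutMul R (lapSymbol + (((m ^ 2 : ℝ) : ℂ)) • logMultiplier hθ) (𝓕 U)),
    Lp.coeFn_sub (cutMul R 1 (𝓕 u₁)) (cutMul R lapSymbol (𝓕 (u t)))]
    with x hA hB h1 h2 h3 h4 h5 h6 h7 h8 h9 h10
  rw [h9, Pi.sub_apply, h10, Pi.sub_apply]
  by_cases hx : ‖x‖ ≤ R
  · rw [h1.1 hx, h2.1 hx, h3.1 hx, h4.1 hx, h7, Pi.sub_apply, h6, Pi.add_apply, h8, Pi.smul_apply,
      hA, hB, h5]
    have hn : ‖(2 * Real.pi) • x‖ = 2 * Real.pi * ‖x‖ := by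
      rw [norm_smul, Real.norm_of_nonneg (by positivity)]
    simp only [ContinuousMap.one_apply, ContinuousMap.add_apply, ContinuousMap.smul_apply,
      lapSymbol, logMultiplier, ContinuousMap.coe_mk, hn, smul_eq_mul, Pi.add_apply]
    ring
  · rw [h1.2 hx, h2.2 hx, h3.2 hx, h4.2 hx]
    simp

/-- The Fourier transform of `L²` as a continuous real linear map. -/
def fourierL : L2 n →L[ℝ] L2 n :=
  (Lp.fourierTransformₗᵢ (Space n) ℂ).toContinuousLinearEquiv.toContinuousLinearMap.restrictScalars
    ℝ

/-- If `a`, `b` are the two roots of `λ² + |ξ|² λ + ω(ξ)²`, then the combination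
`û_t - b û` solves a first order equation, so it is equal to `exp (t a) û₁`. -/
lemma IsMildSolution.fourier_deriv_sub {θ m : ℝ} (hθ : 0 < θ) {u₁ : L2 n} {u v : ℝ → L2 n}
    (h : IsMildSolution θ m 0 u₁ u v) {a b : C(Space n, ℂ)} (hab : a + b = -lapSymbol)
    (hab' : a * b = lapSymbol + (((m ^ 2 : ℝ) : ℂ)) • logMultiplier hθ)
    {t : ℝ} (ht : 0 ≤ t) :
    ∀ᵐ x, (𝓕 (v t) : L2 n) x - b x * (𝓕 (u t) : L2 n) x =
      Complex.exp (t * a x) * (𝓕 u₁ : L2 n) x := by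
  have hcont : ContinuousOn u (Ici 0) := fun s hs => (h.hasDeriv s hs).continuousWithinAt
  have main : ∀ R : ℝ, cutMul R 1 (𝓕 (v t)) - cutMul R b (𝓕 (u t)) =
      NormedSpace.exp ((t : ℂ) • cutMul R a) (cutMul R 1 (𝓕 u₁)) := by
    intro R
    have hclm : ∀ (c : C(Space n, ℂ)) (w w' : ℝ → L2 n) (s : ℝ),
        (HasDerivWithinAt w (w' s) (Ici 0) s) →
        HasDerivWithinAt (fun s => cutMul R c (𝓕 (w s))) (cutMul R c (𝓕 (w' s))) (Ici 0) s :=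
      fun c w w' s hw => by
        exact (((cutMul R c).restrictScalars ℝ).comp fourierL).hasFDerivAt.comp_hasDerivWithinAt
          s hw
    have hp := eq_exp_of_hasDerivWithinAt (cutMul R a)
      (fun s => cutMul R 1 (𝓕 (v s)) - cutMul R b (𝓕 (u s))) (fun s hs => ?_) t ht
    · simp only [h.init, h.init_deriv] at hp
      rw [hp]
      have h0 : (𝓕 (0 : L2 n) : L2 n) = 0 := map_zero fourierL
      rw [h0, map_zero, sub_zero]
    · have d1 := hclm lapSymbol u v s (h.hasDeriv s hs)
      have d2 := hclm b u v s (h.hasDeriv s hs)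
      have d3 := hclm (a * b) (fun s => ∫ r in (0 : ℝ)..s, u r) u s
        (hasDerivWithinAt_primitive hcont hs)
      have d4 := (((hasDerivWithinAt_const s (Ici 0) (cutMul R 1 (𝓕 u₁))).sub d1).sub d3).sub d2
      have d5 : HasDerivWithinAt (fun s => cutMul R 1 (𝓕 (v s)) - cutMul R b (𝓕 (u s)))
          (0 - cutMul R lapSymbol (𝓕 (v s)) - cutMul R (a * b) (𝓕 (u s)) - cutMul R b (𝓕 (v s)))
          (Ici 0) s := by
        refine d4.congr (fun r hr => ?_) ?_
        · rw [h.cutMul_fourier_deriv hθ R hr, hab']; rfl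
        · rw [h.cutMul_fourier_deriv hθ R hs, hab']; rfl
      refine d5.congr_deriv ?_
      have ha : a = -lapSymbol + -b := by rw [← hab]; ring
      rw [map_sub, cutMul_cutMul, cutMul_cutMul, mul_one]
      have hav : cutMul R a (𝓕 (v s)) =
          -cutMul R lapSymbol (𝓕 (v s)) + -cutMul R b (𝓕 (v s)) := by
        rw [ha, cutMul_add, cutMul_neg, cutMul_neg]
      rw [hav]
      abel
  -- Countably many balls cover the space, so the exceptional null sets can be united.
  have hall : ∀ᵐ x, ∀ R : ℕ, ‖x‖ ≤ R → (𝓕 (v t) : L2 n) x - b x * (𝓕 (u t) : L2 n) x =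
      Complex.exp (t * a x) * (𝓕 u₁ : L2 n) x := by
    rw [ae_all_iff]
    intro R
    have hm := main R
    have hsm : ((t : ℂ) • cutMul R a : L2 n →L[ℂ] L2 n) = cutMul R ((t : ℂ) • a) := by
      ext1 f
      rw [cutMul_smul]
      rfl
    rw [hsm] at hm
    filter_upwards [exp_cutMul R ((t : ℂ) • a) (𝓕 u₁), ae_cutMul_apply R 1 (𝓕 (v t)),
      ae_cutMul_apply R b (𝓕 (u t)),
      Lp.coeFn_sub (cutMul R 1 (𝓕 (v t))) (cutMul R b (𝓕 (u t)))] with x h1 h2 h3 h4 hx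
    rw [← hm, h4, Pi.sub_apply, h2.1 hx, h3.1 hx] at h1
    simpa using h1 hx
  filter_upwards [hall] with x hx
  obtain ⟨R, hR⟩ := exists_nat_ge ‖x‖
  exact hx R hR

/-- The Fourier multiplier of the solution operator `u₁ ↦ u(t)`, off the zero set of the
discriminant. -/
def kernel (θ m t : ℝ) (ξ : Space n) : ℂ :=
  (Real.exp (-(‖ξ‖ ^ 2 / 2) * t) : ℂ) *
    ((Complex.exp (t * sqrtDisc θ m ξ) - Complex.exp (-(t * sqrtDisc θ m ξ))) /
      (2 * sqrtDisc θ m ξ))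

/-- The discriminant vanishes on at most one sphere besides the origin: `r²/4 - 1` is increasing in
`r`, while `log(1 + r^(2θ)) / r²` is nonincreasing by Bernoulli's inequality. -/
lemma norm_le_of_disc_eq_zero {θ m : ℝ} (hθ' : θ ≤ 1) {ξ η : Space n}
    (hξ : ξ ≠ 0) (h1 : disc θ m ξ = 0) (h2 : disc θ m η = 0) : ‖η‖ ≤ ‖ξ‖ := by
  by_contra! hlt
  have hr : 0 < ‖ξ‖ := norm_pos_iff.2 hξ
  set x := ‖ξ‖ ^ 2 with hx
  set y := ‖η‖ ^ 2 with hy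
  have hx0 : 0 < x := by positivity
  have hxy : x < y := pow_lt_pow_left₀ hlt (norm_nonneg _) two_ne_zero
  rw [disc, omega_sq, logSymbol, Real.rpow_mul (norm_nonneg _), Real.rpow_two, ← hx] at h1
  rw [disc, omega_sq, logSymbol, Real.rpow_mul (norm_nonneg _), Real.rpow_two, ← hy] at h2
  have e1 : ‖ξ‖ ^ 4 = x ^ 2 := by rw [hx]; ring
  have e2 : ‖η‖ ^ 4 = y ^ 2 := by rw [hy]; ring
  rw [e1] at h1
  rw [e2] at h2
  have hy0 : 0 < y := hx0.trans hxy
  have hxθ : 0 < x ^ θ := Real.rpow_pos_of_pos hx0 θ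
  have hyθ : 0 < y ^ θ := Real.rpow_pos_of_pos hy0 θ
  have hc : 1 ≤ y / x := (one_le_div hx0).2 hxy.le
  have hbern := one_add_mul_self_le_rpow_one_add (s := x ^ θ) (by linarith) hc
  have hyx : y ^ θ ≤ y / x * x ^ θ := by
    calc y ^ θ = (y / x) ^ θ * x ^ θ := by
          rw [← Real.mul_rpow (by positivity) hx0.le, div_mul_cancel₀ _ hx0.ne']
      _ ≤ (y / x) ^ (1 : ℝ) * x ^ θ := by gcongr
      _ = _ := by rw [Real.rpow_one]
  have hlog : Real.log (1 + y ^ θ) ≤ y / x * Real.log (1 + x ^ θ) := by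
    rw [← Real.log_rpow (by positivity)]
    exact Real.log_le_log (by positivity) (by linarith)
  have hlog' : x * Real.log (1 + y ^ θ) ≤ y * Real.log (1 + x ^ θ) := by
    calc x * Real.log (1 + y ^ θ) ≤ x * (y / x * Real.log (1 + x ^ θ)) := by gcongr
      _ = _ := by field_simp
  have hm := mul_le_mul_of_nonneg_left hlog' (sq_nonneg m)
  have : x * y * (y - x) ≤ 0 := by nlinarith
  have : 0 < x * y * (y - x) := by have := sub_pos.2 hxy; positivity
  linarith

/-- The two characteristic roots are distinct at almost every frequency. -/
lemma ae_disc_ne_zero (hn : 1 ≤ n) {θ m : ℝ} (hθ' : θ ≤ 1) :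
    ∀ᵐ ξ : Space n, ξ ≠ 0 ∧ disc θ m ξ ≠ 0 := by
  have : Nonempty (Fin n) := ⟨⟨0, hn⟩⟩
  have h0 : ∀ᵐ ξ : Space n, ξ ≠ 0 := by
    simp [ae_iff]
  by_cases hex : ∃ ξ : Space n, ξ ≠ 0 ∧ disc θ m ξ = 0
  · obtain ⟨ξ₀, h1, h2⟩ := hex
    have hs : ∀ᵐ ξ : Space n, ξ ∉ Metric.sphere (0 : Space n) ‖ξ₀‖ :=
      measure_eq_zero_iff_ae_notMem.1
        (Measure.addHaar_sphere volume (0 : Space n) ‖ξ₀‖)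
    filter_upwards [h0, hs] with ξ h3 h4
    refine ⟨h3, fun h5 => h4 ?_⟩
    rw [mem_sphere_zero_iff_norm]
    exact le_antisymm (norm_le_of_disc_eq_zero hθ' h1 h2 h5)
      (norm_le_of_disc_eq_zero hθ' h3 h5 h2)
  · push Not at hex
    filter_upwards [h0] with ξ h3
    exact ⟨h3, hex ξ h3⟩

/-- Null sets in the frequency variable `ξ` and in the variable `x = ξ / (2π)` correspond. -/
lemma ae_comp_scaling {p : Space n → Prop} (h : ∀ᵐ x, p x) :
    ∀ᵐ ξ : Space n, p ((2 * Real.pi)⁻¹ • ξ) :=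
  (Measure.quasiMeasurePreserving_smul volume
    (inv_ne_zero (by positivity : (2 * Real.pi : ℝ) ≠ 0))).ae h

/-- The solution formula `û(t, ξ) = K(t, ξ) û₁(ξ)`. -/
lemma IsMildSolution.hat_eq (hn : 1 ≤ n) {θ m : ℝ} (hθ : 0 < θ) (hθ' : θ ≤ 1) {u₁ : L2 n}
    {u v : ℝ → L2 n} (h : IsMildSolution θ m 0 u₁ u v) {t : ℝ} (ht : 0 ≤ t) :
    ∀ᵐ ξ : Space n, hat (u t) ξ = kernel θ m t ξ * hat u₁ ξ := by
  set a : C(Space n, ℂ) := -((1 / 2 : ℂ) • lapSymbol) + sqrtDiscMultiplier hθ m with ha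
  set b : C(Space n, ℂ) := -((1 / 2 : ℂ) • lapSymbol) - sqrtDiscMultiplier hθ m with hb
  have hab : a + b = -lapSymbol := by
    ext x
    simp only [ha, hb, ContinuousMap.add_apply, ContinuousMap.sub_apply, ContinuousMap.neg_apply,
      ContinuousMap.smul_apply, smul_eq_mul]
    ring
  have hab' : a * b = lapSymbol + (((m ^ 2 : ℝ) : ℂ)) • logMultiplier hθ := by
    ext x
    have hs := sqrtDisc_sq θ m ((2 * Real.pi) • x)
    rw [disc, omega_sq] at hs
    simp only [ha, hb, ContinuousMap.add_apply, ContinuousMap.sub_apply, ContinuousMap.neg_apply,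
      ContinuousMap.smul_apply, ContinuousMap.mul_apply, smul_eq_mul, lapSymbol,
      sqrtDiscMultiplier, logMultiplier, ContinuousMap.coe_mk]
    push_cast at hs ⊢
    linear_combination -hs
  have hba : b + a = -lapSymbol := by rw [add_comm, hab]
  have hba' : b * a = lapSymbol + (((m ^ 2 : ℝ) : ℂ)) • logMultiplier hθ := by
    rw [mul_comm, hab']
  -- The difference of the two identities eliminates `û_t` and leaves `2 √(disc ξ) û`.
  filter_upwards [ae_comp_scaling (h.fourier_deriv_sub hθ hab hab' ht),
    ae_comp_scaling (h.fourier_deriv_sub hθ hba hba' ht), ae_disc_ne_zero (m := m) hn hθ']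
    with ξ h1 h2 h3
  have hscale : (2 * Real.pi) • (2 * Real.pi)⁻¹ • ξ = ξ :=
    smul_inv_smul₀ (by positivity) ξ
  simp only [ha, hb, ContinuousMap.add_apply, ContinuousMap.sub_apply, ContinuousMap.neg_apply,
    ContinuousMap.smul_apply, smul_eq_mul, lapSymbol, sqrtDiscMultiplier, ContinuousMap.coe_mk,
    hscale] at h1 h2
  have hs0 : sqrtDisc θ m ξ ≠ 0 := by
    intro h0
    have := sqrtDisc_sq θ m ξ
    rw [h0, zero_pow two_ne_zero] at this
    exact h3.2 (by exact_mod_cast this.symm)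
  rw [hat, hat, kernel]
  set s := sqrtDisc θ m ξ
  have e1 : Complex.exp (t * (-(1 / 2 * ((‖ξ‖ ^ 2 : ℝ) : ℂ)) + s)) =
      (Real.exp (-(‖ξ‖ ^ 2 / 2) * t) : ℂ) * Complex.exp (t * s) := by
    rw [Complex.ofReal_exp, ← Complex.exp_add]
    congr 1
    push_cast
    ring
  have e2 : Complex.exp (t * (-(1 / 2 * ((‖ξ‖ ^ 2 : ℝ) : ℂ)) - s)) =
      (Real.exp (-(‖ξ‖ ^ 2 / 2) * t) : ℂ) * Complex.exp (-(t * s)) := by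
    rw [Complex.ofReal_exp, ← Complex.exp_add]
    congr 1
    push_cast
    ring
  rw [e1] at h1
  rw [e2] at h2
  rw [mul_div_assoc', div_mul_eq_mul_div, eq_div_iff (mul_ne_zero two_ne_zero hs0)]
  linear_combination h1 - h2

/-! ### Pointwise bounds for the solution kernel -/

lemma kernel_eq_sin {θ m t : ℝ} {ξ : Space n} (h : disc θ m ξ < 0) :
    kernel θ m t ξ = ((Real.exp (-(‖ξ‖ ^ 2 / 2) * t) *
      (Real.sin (t * Real.sqrt (-disc θ m ξ)) / Real.sqrt (-disc θ m ξ)) : ℝ) : ℂ) := by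
  have hs : sqrtDisc θ m ξ = (Real.sqrt (-disc θ m ξ) : ℂ) * Complex.I := by
    rw [sqrtDisc, Real.sqrt_eq_zero_of_nonpos h.le]
    simp
  have hb : Real.sqrt (-disc θ m ξ) ≠ 0 := (Real.sqrt_pos.2 (neg_pos.2 h)).ne'
  rw [kernel, hs]
  set b := Real.sqrt (-disc θ m ξ)
  have hb' : (b : ℂ) ≠ 0 := by exact_mod_cast hb
  push_cast
  congr 1
  rw [Complex.sin]
  have e1 : (t : ℂ) * (b * Complex.I) = t * b * Complex.I := by ring
  have e2 : -((t : ℂ) * (b * Complex.I)) = -(t * b) * Complex.I := by ring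
  rw [e2, e1]
  field_simp
  rw [Complex.I_sq]
  ring

lemma kernel_eq_sinh {θ m t : ℝ} {ξ : Space n} (h : 0 < disc θ m ξ) :
    kernel θ m t ξ = ((Real.exp (-(‖ξ‖ ^ 2 / 2) * t) *
      (Real.sinh (t * Real.sqrt (disc θ m ξ)) / Real.sqrt (disc θ m ξ)) : ℝ) : ℂ) := by
  have hs : sqrtDisc θ m ξ = (Real.sqrt (disc θ m ξ) : ℂ) := by
    rw [sqrtDisc, Real.sqrt_eq_zero_of_nonpos (neg_nonpos.2 h.le)]
    simp
  have hb : Real.sqrt (disc θ m ξ) ≠ 0 := (Real.sqrt_pos.2 h).ne'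
  rw [kernel, hs]
  set b := Real.sqrt (disc θ m ξ)
  have hb' : (b : ℂ) ≠ 0 := by exact_mod_cast hb
  push_cast
  congr 1
  rw [Complex.sinh]
  field_simp

lemma abs_sin_mul_div_le {t b : ℝ} (ht : 0 ≤ t) (hb : 0 < b) :
    |Real.sin (t * b) / b| ≤ t := by
  rw [abs_div, abs_of_pos hb, div_le_iff₀ hb]
  exact Real.abs_sin_le_abs.trans_eq (abs_of_nonneg (by positivity))

lemma exp_sq_eq (x : ℝ) : Real.exp x ^ 2 = Real.exp (2 * x) := by
  rw [← Real.exp_nat_mul]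
  norm_cast

lemma sinh_le_mul_exp (x : ℝ) : Real.sinh x ≤ x * Real.exp x := by
  have h := Real.add_one_le_exp (-(2 * x))
  have h2 : Real.exp x * Real.exp (-(2 * x)) = Real.exp (-x) := by
    rw [← Real.exp_add]
    ring_nf
  have h3 := mul_le_mul_of_nonneg_left h (Real.exp_pos x).le
  rw [h2] at h3
  rw [Real.sinh_eq]
  linarith

lemma norm_kernel_le_of_disc_neg {θ m t : ℝ} {ξ : Space n} (ht : 0 ≤ t) (h : disc θ m ξ < 0) :
    ‖kernel θ m t ξ‖ ≤ t * Real.exp (-(‖ξ‖ ^ 2 / 2) * t) := by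
  rw [kernel_eq_sin h, Complex.norm_real, Real.norm_eq_abs, abs_mul, abs_of_pos (Real.exp_pos _),
    mul_comm]
  gcongr
  exact abs_sin_mul_div_le ht (Real.sqrt_pos.2 (neg_pos.2 h))

lemma norm_kernel_of_disc_pos {θ m t : ℝ} {ξ : Space n} (ht : 0 ≤ t) (h : 0 < disc θ m ξ) :
    ‖kernel θ m t ξ‖ = Real.exp (-(‖ξ‖ ^ 2 / 2) * t) *
      (Real.sinh (t * Real.sqrt (disc θ m ξ)) / Real.sqrt (disc θ m ξ)) := by
  rw [kernel_eq_sinh h, Complex.norm_real, Real.norm_of_nonneg]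
  have : 0 ≤ Real.sinh (t * Real.sqrt (disc θ m ξ)) := Real.sinh_nonneg_iff.2 (by positivity)
  positivity

lemma norm_kernel_le_of_disc_pos {θ m t : ℝ} {ξ : Space n} (ht : 0 ≤ t) (h : 0 < disc θ m ξ) :
    ‖kernel θ m t ξ‖ ≤ t * Real.exp (-(‖ξ‖ ^ 2 / 2 - Real.sqrt (disc θ m ξ)) * t) := by
  rw [norm_kernel_of_disc_pos ht h]
  have hb := Real.sqrt_pos.2 h
  set b := Real.sqrt (disc θ m ξ)
  have h1 : Real.sinh (t * b) / b ≤ t * Real.exp (t * b) := by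
    rw [div_le_iff₀ hb]
    refine (sinh_le_mul_exp _).trans_eq ?_
    ring
  calc _ ≤ Real.exp (-(‖ξ‖ ^ 2 / 2) * t) * (t * Real.exp (t * b)) := by gcongr
    _ = t * (Real.exp (-(‖ξ‖ ^ 2 / 2) * t) * Real.exp (t * b)) := by ring
    _ = _ := by
      rw [← Real.exp_add]
      ring_nf

/-- Where the roots are real, the larger one is at most `-1`, because `ω(ξ)² ≥ |ξ|²`. -/
lemma sqrt_disc_le {θ m : ℝ} {ξ : Space n} (h : 0 < disc θ m ξ) :
    Real.sqrt (disc θ m ξ) ≤ ‖ξ‖ ^ 2 / 2 - 1 := by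
  have hω : ‖ξ‖ ^ 2 ≤ omega θ m ξ ^ 2 := by
    rw [omega_sq]
    have := logSymbol_nonneg θ ξ
    have : 0 ≤ m ^ 2 * logSymbol θ ξ := by positivity
    linarith
  rw [disc] at h ⊢
  have h4 : ‖ξ‖ ^ 4 = (‖ξ‖ ^ 2) ^ 2 := by ring
  rw [h4] at h ⊢
  have h5 : 4 < ‖ξ‖ ^ 2 := by
    by_contra! hle
    have : 0 ≤ ‖ξ‖ ^ 2 := by positivity
    nlinarith
  rw [Real.sqrt_le_left (by linarith)]
  nlinarith

/-- For `|ξ| ≥ 1` the solution decays exponentially in time, uniformly in `m` and `ξ`. -/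
lemma norm_kernel_sq_le {θ m t : ℝ} {ξ : Space n} (ht : 0 ≤ t) (hξ : 1 ≤ ‖ξ‖)
    (h : disc θ m ξ ≠ 0) : ‖kernel θ m t ξ‖ ^ 2 ≤ t ^ 2 * Real.exp (-t) := by
  have h1 : 1 ≤ ‖ξ‖ ^ 2 := one_le_pow₀ hξ
  have key : ‖kernel θ m t ξ‖ ≤ t * Real.exp (-t / 2) := by
    rcases lt_or_gt_of_ne h with h | h
    · refine (norm_kernel_le_of_disc_neg ht h).trans ?_
      gcongr
      nlinarith
    · refine (norm_kernel_le_of_disc_pos ht h).trans ?_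
      have := sqrt_disc_le h
      gcongr
      nlinarith
  calc _ ≤ (t * Real.exp (-t / 2)) ^ 2 := by gcongr
    _ = _ := by
      rw [mul_pow, ← Real.exp_nat_mul]
      push_cast
      ring_nf

/-- A bound which also decays in `ξ`: the first term covers complex roots and real roots with
`√(disc ξ) ≤ |ξ|²/4`, and the second one covers real roots which are farther apart. -/
lemma norm_kernel_sq_le' {θ m t : ℝ} {ξ : Space n} (ht : 0 ≤ t) (hξ : 1 ≤ ‖ξ‖)
    (h : disc θ m ξ ≠ 0) : ‖kernel θ m t ξ‖ ^ 2 ≤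
      t ^ 2 * Real.exp (-(‖ξ‖ ^ 2 / 2) * t) + 4 * (‖ξ‖ ^ 4)⁻¹ * Real.exp (-(2 * t)) := by
  have first : ‖kernel θ m t ξ‖ ≤ t * Real.exp (-(‖ξ‖ ^ 2 / 4) * t) → ‖kernel θ m t ξ‖ ^ 2 ≤
      t ^ 2 * Real.exp (-(‖ξ‖ ^ 2 / 2) * t) + 4 * (‖ξ‖ ^ 4)⁻¹ * Real.exp (-(2 * t)) := by
    intro hk
    calc _ ≤ (t * Real.exp (-(‖ξ‖ ^ 2 / 4) * t)) ^ 2 := by gcongr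
      _ = t ^ 2 * Real.exp (-(‖ξ‖ ^ 2 / 2) * t) := by
        rw [mul_pow, exp_sq_eq]
        ring_nf
      _ ≤ _ := le_add_of_nonneg_right (by positivity)
  rcases lt_or_gt_of_ne h with h | h
  · refine first ((norm_kernel_le_of_disc_neg ht h).trans ?_)
    gcongr
    nlinarith [sq_nonneg ‖ξ‖]
  · rcases le_total (Real.sqrt (disc θ m ξ)) (‖ξ‖ ^ 2 / 4) with hβ | hβ
    · refine first ((norm_kernel_le_of_disc_pos ht h).trans ?_)
      gcongr
      nlinarith [sq_nonneg ‖ξ‖]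
    · have hle := sqrt_disc_le h
      have hk : ‖kernel θ m t ξ‖ ≤ 2 * (‖ξ‖ ^ 2)⁻¹ * Real.exp (-t) := by
        rw [norm_kernel_of_disc_pos ht h]
        have hb := Real.sqrt_pos.2 h
        set b := Real.sqrt (disc θ m ξ)
        have h1 : Real.sinh (t * b) ≤ Real.exp (t * b) / 2 := by
          rw [Real.sinh_eq]
          have := Real.exp_pos (-(t * b))
          linarith
        have h2 : Real.exp (t * b) ≤ Real.exp (t * (‖ξ‖ ^ 2 / 2 - 1)) := by gcongr
        have h3 : Real.exp (-(‖ξ‖ ^ 2 / 2) * t) * Real.exp (t * (‖ξ‖ ^ 2 / 2 - 1)) =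
            Real.exp (-t) := by
          rw [← Real.exp_add]
          ring_nf
        calc _ ≤ Real.exp (-(‖ξ‖ ^ 2 / 2) * t) *
              (Real.exp (t * (‖ξ‖ ^ 2 / 2 - 1)) / 2 / (‖ξ‖ ^ 2 / 4)) := by
              gcongr
              linarith
          _ = 2 * (‖ξ‖ ^ 2)⁻¹ * (Real.exp (-(‖ξ‖ ^ 2 / 2) * t) *
              Real.exp (t * (‖ξ‖ ^ 2 / 2 - 1))) := by
              field_simp
              ring
          _ = _ := by rw [h3]
      calc _ ≤ (2 * (‖ξ‖ ^ 2)⁻¹ * Real.exp (-t)) ^ 2 := by gcongr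
        _ = 4 * (‖ξ‖ ^ 4)⁻¹ * Real.exp (-(2 * t)) := by
          rw [mul_pow, exp_sq_eq, mul_pow, inv_pow, ← pow_mul]
          ring_nf
        _ ≤ _ := le_add_of_nonneg_left (by positivity)

/-! ### Low frequencies -/

lemma half_rpow_le_logSymbol {θ : ℝ} (hθ : 0 < θ) {ξ : Space n} (hξ : ‖ξ‖ ≤ 1) :
    (‖ξ‖ ^ θ) ^ 2 / 2 ≤ logSymbol θ ξ := by
  have h0 : 0 ≤ ‖ξ‖ ^ θ := Real.rpow_nonneg (norm_nonneg _) _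
  have h1 : ‖ξ‖ ^ θ ≤ 1 := Real.rpow_le_one (norm_nonneg _) hξ hθ.le
  have he : ‖ξ‖ ^ (2 * θ) = (‖ξ‖ ^ θ) ^ 2 := by
    rw [mul_comm, Real.rpow_mul (norm_nonneg _), Real.rpow_two]
  rw [logSymbol, he]
  set x := (‖ξ‖ ^ θ) ^ 2
  have hx0 : 0 ≤ x := by positivity
  have hx1 : x ≤ 1 := pow_le_one₀ h0 h1
  refine le_trans ?_ (Real.one_sub_inv_le_log_of_pos (by linarith))
  have : 1 - (1 + x)⁻¹ = x / (1 + x) := by field_simp; ring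
  rw [this]
  exact div_le_div_of_nonneg_left hx0 (by linarith) (by linarith)

/-- For `|ξ| ≤ 1` the roots are not real, and the frequency of the oscillation is at least
`m |ξ|^θ / 2`. -/
lemma disc_le_of_norm_le_one {θ m : ℝ} (hθ : 0 < θ) {ξ : Space n} (hξ : ‖ξ‖ ≤ 1) :
    disc θ m ξ ≤ -(m * ‖ξ‖ ^ θ / 2) ^ 2 := by
  have h1 := mul_le_mul_of_nonneg_left (half_rpow_le_logSymbol hθ hξ) (sq_nonneg m)
  have h2 : ‖ξ‖ ^ 4 ≤ ‖ξ‖ ^ 2 := pow_le_pow_of_le_one (norm_nonneg _) hξ (by norm_num)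
  rw [disc, omega_sq]
  nlinarith [sq_nonneg ‖ξ‖, sq_nonneg (m * ‖ξ‖ ^ θ)]

/-- Comparison of two oscillations with frequencies `b ≤ ω`. -/
lemma abs_sin_div_sub_sin_div_le {t b w : ℝ} (ht : 0 ≤ t) (hb : 0 < b) (hbw : b ≤ w) :
    |Real.sin (t * b) / b - Real.sin (t * w) / w| ≤ (w - b) * (t + w⁻¹) / b := by
  have hw : 0 < w := hb.trans_le hbw
  have h1 : |Real.sin (t * b) - Real.sin (t * w)| ≤ t * (w - b) := by
    have h := Real.abs_sin_sub_sin_le (t * b) (t * w)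
    rwa [← mul_sub, abs_mul, abs_of_nonneg ht, abs_sub_comm b,
      abs_of_nonneg (sub_nonneg.2 hbw)] at h
  have h2 := Real.abs_sin_le_one (t * w)
  have e : Real.sin (t * b) / b - Real.sin (t * w) / w =
      ((Real.sin (t * b) - Real.sin (t * w)) + Real.sin (t * w) * ((w - b) * w⁻¹)) / b := by
    field_simp
    ring
  rw [e, abs_div, abs_of_pos hb]
  gcongr
  refine (abs_add_le _ _).trans ?_
  rw [abs_mul, abs_of_nonneg (mul_nonneg (sub_nonneg.2 hbw) (inv_nonneg.2 hw.le))]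
  have h3 := mul_le_mul_of_nonneg_right h2 (mul_nonneg (sub_nonneg.2 hbw) (inv_nonneg.2 hw.le))
  nlinarith

lemma one_add_mul_exp_neg_half_le (x : ℝ) :
    (1 + x) * Real.exp (-(x / 2)) ≤ 4 * Real.exp (-(x / 4)) := by
  have h := Real.add_one_le_exp (x / 4)
  have h2 : Real.exp (-(x / 2)) * Real.exp (x / 4) = Real.exp (-(x / 4)) := by
    rw [← Real.exp_add]
    ring_nf
  rw [← h2, mul_comm (1 + x), mul_left_comm]
  exact mul_le_mul_of_nonneg_left (by linarith) (Real.exp_pos _).le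

/-- For low frequencies the kernel differs from the multiplier of the asymptotic profile by at most
`2 m⁻¹ exp(-|ξ|² t / 4)`. -/
lemma norm_kernel_sub_le {θ m t : ℝ} (hθ : 0 < θ) (hθ' : θ ≤ 1) (hm : 0 < m) (ht : 0 ≤ t)
    {ξ : Space n} (hξ0 : ξ ≠ 0) (hξ : ‖ξ‖ ≤ 1) :
    ‖kernel θ m t ξ - ((Real.exp (-(‖ξ‖ ^ 2 / 2) * t) *
      (Real.sin (t * omega θ m ξ) / omega θ m ξ) : ℝ) : ℂ)‖ ≤
      2 * m⁻¹ * Real.exp (-(‖ξ‖ ^ 2 / 4) * t) := by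
  have hr : 0 < ‖ξ‖ := norm_pos_iff.2 hξ0
  have hrθ : ‖ξ‖ ≤ ‖ξ‖ ^ θ := by
    calc ‖ξ‖ = ‖ξ‖ ^ (1 : ℝ) := (Real.rpow_one _).symm
      _ ≤ _ := Real.rpow_le_rpow_of_exponent_ge hr hξ hθ'
  have hd := disc_le_of_norm_le_one (m := m) hθ hξ
  have hpos : 0 < m * ‖ξ‖ ^ θ / 2 := by positivity
  have hneg : disc θ m ξ < 0 := lt_of_le_of_lt hd (neg_neg_of_pos (by positivity))
  rw [kernel_eq_sin hneg, ← Complex.ofReal_sub, Complex.norm_real, ← mul_sub, Real.norm_eq_abs,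
    abs_mul, abs_of_pos (Real.exp_pos _)]
  set b := Real.sqrt (-disc θ m ξ) with hb
  set w := omega θ m ξ with hw
  have hbsq : b ^ 2 = w ^ 2 - ‖ξ‖ ^ 4 / 4 := by
    rw [hb, Real.sq_sqrt (by linarith), disc]
    ring
  have hbm : m * ‖ξ‖ / 2 ≤ b := by
    refine le_trans ?_ (Real.le_sqrt_of_sq_le (le_neg.2 hd))
    gcongr
  have hb0 : 0 < b := lt_of_lt_of_le (by positivity) hbm
  have hrw : ‖ξ‖ ≤ w := by
    rw [hw, omega]
    refine Real.le_sqrt_of_sq_le (le_add_of_nonneg_right ?_)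
    have := logSymbol_nonneg θ ξ
    positivity
  have hw0 : 0 < w := hr.trans_le hrw
  have hbw : b ≤ w := by
    refine (abs_le_of_sq_le_sq' ?_ hw0.le).2
    rw [hbsq]
    have : 0 ≤ ‖ξ‖ ^ 4 := by positivity
    linarith
  have hdiff : w - b ≤ ‖ξ‖ ^ 3 / 4 := by
    have h1 : (w - b) * (w + b) = ‖ξ‖ ^ 4 / 4 := by linear_combination -hbsq
    have h2 : (w - b) * ‖ξ‖ ≤ (w - b) * (w + b) :=
      mul_le_mul_of_nonneg_left (by linarith) (sub_nonneg.2 hbw)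
    rw [h1] at h2
    refine le_of_mul_le_mul_right (h2.trans_eq ?_) hr
    ring
  have hsin := abs_sin_div_sub_sin_div_le ht hb0 hbw
  have hsin2 : |Real.sin (t * b) / b - Real.sin (t * w) / w| ≤ (1 + ‖ξ‖ ^ 2 * t) / (2 * m) := by
    calc _ ≤ _ := hsin
      _ ≤ ‖ξ‖ ^ 3 / 4 * (t + ‖ξ‖⁻¹) / (m * ‖ξ‖ / 2) := by gcongr
      _ = (‖ξ‖ + ‖ξ‖ ^ 2 * t) / (2 * m) := by field_simp; ring
      _ ≤ _ := by gcongr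
  have hexp := one_add_mul_exp_neg_half_le (‖ξ‖ ^ 2 * t)
  calc _ ≤ Real.exp (-(‖ξ‖ ^ 2 / 2) * t) * ((1 + ‖ξ‖ ^ 2 * t) / (2 * m)) := by gcongr
    _ = ((1 + ‖ξ‖ ^ 2 * t) * Real.exp (-(‖ξ‖ ^ 2 * t / 2))) / (2 * m) := by ring_nf
    _ ≤ (4 * Real.exp (-(‖ξ‖ ^ 2 * t / 4))) / (2 * m) := by gcongr
    _ = _ := by field_simp; ring_nf

/-- For low frequencies the kernel has at most the singularity `2 m⁻¹ |ξ|^(-θ)`. -/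
lemma norm_kernel_mul_rpow_le {θ m t : ℝ} (hθ : 0 < θ) (hm : 0 < m) (ht : 0 ≤ t)
    {ξ : Space n} (hξ0 : ξ ≠ 0) (hξ : ‖ξ‖ ≤ 1) :
    ‖kernel θ m t ξ‖ * ‖ξ‖ ^ θ ≤ 2 * m⁻¹ * Real.exp (-(‖ξ‖ ^ 2 / 4) * t) := by
  have hr : 0 < ‖ξ‖ := norm_pos_iff.2 hξ0
  have hrθ : 0 < ‖ξ‖ ^ θ := Real.rpow_pos_of_pos hr θ
  have hd := disc_le_of_norm_le_one (m := m) hθ hξ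
  have hneg : disc θ m ξ < 0 := lt_of_le_of_lt hd (neg_neg_of_pos (by positivity))
  rw [kernel_eq_sin hneg, Complex.norm_real, Real.norm_eq_abs, abs_mul,
    abs_of_pos (Real.exp_pos _), abs_div, abs_of_nonneg (Real.sqrt_nonneg _)]
  have hbm : m * ‖ξ‖ ^ θ / 2 ≤ Real.sqrt (-disc θ m ξ) := Real.le_sqrt_of_sq_le (le_neg.2 hd)
  set b := Real.sqrt (-disc θ m ξ)
  calc _ ≤ Real.exp (-(‖ξ‖ ^ 2 / 4) * t) * (1 / (m * ‖ξ‖ ^ θ / 2)) * ‖ξ‖ ^ θ := by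
        gcongr
        · nlinarith [sq_nonneg ‖ξ‖]
        · exact Real.abs_sin_le_one _
    _ = _ := by field_simp

/-! ### The Fourier transform of the initial velocity -/

lemma hat_ae_eq_integral (f : L2 n) (hf : Integrable (fun x => f x) volume) :
    ∀ᵐ ξ : Space n, hat f ξ = ∫ x, Complex.exp (((-inner ℝ x ξ : ℝ) : ℂ) * Complex.I) * f x := by
  filter_upwards [ae_comp_scaling (fourier_ae_eq_integral f hf)] with ξ hξ
  rw [hat, hξ, Real.fourier_eq']
  refine integral_congr_ae (Eventually.of_forall fun x => ?_)
  simp only [smul_eq_mul, inner_smul_right]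
  congr 4
  field_simp

lemma norm_exp_mul_I_sub_one_le {θ : ℝ} (hθ : 0 < θ) (hθ' : θ ≤ 1) (y : ℝ) :
    ‖Complex.exp ((y : ℂ) * Complex.I) - 1‖ ≤ 2 * |y| ^ θ := by
  rcases le_total |y| 1 with h | h
  · have h1 : ‖Complex.exp ((y : ℂ) * Complex.I) - 1‖ ≤ |y| := by
      have := Real.norm_exp_I_mul_ofReal_sub_one_le (x := y)
      rwa [mul_comm, Real.norm_eq_abs] at this
    have h2 : |y| ≤ |y| ^ θ := by
      rcases (abs_nonneg y).eq_or_lt with h0 | h0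
      · rw [← h0]
        positivity
      · calc |y| = |y| ^ (1 : ℝ) := (Real.rpow_one _).symm
          _ ≤ _ := Real.rpow_le_rpow_of_exponent_ge h0 h hθ'
    have : 0 ≤ |y| ^ θ := by positivity
    linarith
  · have h1 : 1 ≤ |y| ^ θ := Real.one_le_rpow h hθ.le
    calc _ ≤ ‖Complex.exp ((y : ℂ) * Complex.I)‖ + ‖(1 : ℂ)‖ := norm_sub_le _ _
      _ = 2 := by rw [Complex.norm_exp_ofReal_mul_I, norm_one]; norm_num
      _ ≤ _ := by linarith

lemma norm_hat_le (f : L2 n) (hf : Integrable (fun x => f x) volume) :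
    ∀ᵐ ξ : Space n, ‖hat f ξ‖ ≤ L1Norm f := by
  filter_upwards [hat_ae_eq_integral f hf] with ξ hξ
  rw [hξ]
  refine (norm_integral_le_integral_norm _).trans_eq ?_
  simp only [norm_mul, Complex.norm_exp_ofReal_mul_I, one_mul, L1Norm]

/-- The Fourier transform of a function in `L^{1,θ}` is Hölder continuous at the origin. -/
lemma norm_hat_sub_moment_le {θ : ℝ} (hθ : 0 < θ) (hθ' : θ ≤ 1) (f : L2 n)
    (hf : InWeightedL1 θ f) :
    ∀ᵐ ξ : Space n, ‖hat f ξ - moment f‖ ≤ 2 * ‖ξ‖ ^ θ * weightedL1Norm θ f := by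
  filter_upwards [hat_ae_eq_integral f hf.1] with ξ hξ
  have hint : Integrable (fun x : Space n =>
      Complex.exp (((-inner ℝ x ξ : ℝ) : ℂ) * Complex.I) * f x) := by
    refine hf.1.bdd_mul (c := 1) ?_ ?_
    · exact (by fun_prop : Continuous fun x : Space n =>
        Complex.exp (((-inner ℝ x ξ : ℝ) : ℂ) * Complex.I)).aestronglyMeasurable
    · exact Eventually.of_forall fun x => (Complex.norm_exp_ofReal_mul_I _).le
  rw [hξ, moment, ← integral_sub hint hf.1, weightedL1Norm, ← integral_const_mul]
  refine norm_integral_le_of_norm_le (hf.2.const_mul _) (Eventually.of_forall fun x => ?_)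
  rw [← sub_one_mul, norm_mul]
  have h1 := norm_exp_mul_I_sub_one_le hθ hθ' (-inner ℝ x ξ)
  have h2 : |-inner ℝ x ξ| ^ θ ≤ ‖x‖ ^ θ * ‖ξ‖ ^ θ := by
    rw [abs_neg, ← Real.mul_rpow (norm_nonneg _) (norm_nonneg _)]
    exact Real.rpow_le_rpow (abs_nonneg _) (abs_real_inner_le_norm x ξ) hθ.le
  have h3 : 0 ≤ ‖ξ‖ ^ θ := by positivity
  calc _ ≤ 2 * (‖x‖ ^ θ * ‖ξ‖ ^ θ) * ‖f x‖ := by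
        gcongr
        exact h1.trans (by linarith)
    _ ≤ 2 * ((1 + ‖x‖ ^ θ) * ‖ξ‖ ^ θ) * ‖f x‖ := by
        gcongr
        linarith
    _ = _ := by ring

lemma norm_moment_le {θ : ℝ} (f : L2 n) (hf : InWeightedL1 θ f) :
    ‖moment f‖ ≤ weightedL1Norm θ f := by
  refine norm_integral_le_of_norm_le hf.2 (Eventually.of_forall fun x => ?_)
  have : 0 ≤ ‖x‖ ^ θ := by positivity
  exact le_mul_of_one_le_left (norm_nonneg _) (by linarith)

lemma weightedL1Norm_nonneg (θ : ℝ) (f : L2 n) : 0 ≤ weightedL1Norm θ f :=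
  integral_nonneg fun x => by positivity

/-! ### The error in the frequency variable -/

/-- For `|ξ| > 1` one has `ω(ξ)² ≥ m² / 2`, so the profile is controlled by `m⁻¹`. -/
lemma norm_profile_sq_le {θ m : ℝ} (hθ : 0 < θ) (hm : 0 < m) {t : ℝ} (ht : 0 ≤ t)
    (u₁ : L2 n) {ξ : Space n} (hξ : 1 ≤ ‖ξ‖) :
    ‖profile θ m u₁ t ξ‖ ^ 2 ≤
      2 * (m ^ 2)⁻¹ * ‖moment u₁‖ ^ 2 * Real.exp (-(t / 2) * ‖ξ‖ ^ 2) := by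
  have hlog : 1 / 2 ≤ logSymbol θ ξ := by
    have h1 : 1 ≤ ‖ξ‖ ^ (2 * θ) := Real.one_le_rpow hξ (by positivity)
    have h2 : Real.log 2 ≤ logSymbol θ ξ := Real.log_le_log (by norm_num) (by linarith)
    linarith [Real.log_two_gt_d9]
  have hω : m ^ 2 / 2 ≤ omega θ m ξ ^ 2 := by
    rw [omega_sq]
    have := mul_le_mul_of_nonneg_left hlog (sq_nonneg m)
    nlinarith [sq_nonneg ‖ξ‖]
  have hsin : Real.sin (t * omega θ m ξ) ^ 2 ≤ 1 := Real.sin_sq_le_one _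
  have hexp : Real.exp (-(‖ξ‖ ^ 2 / 2) * t) ^ 2 ≤ Real.exp (-(t / 2) * ‖ξ‖ ^ 2) := by
    rw [← Real.exp_nat_mul, Real.exp_le_exp]
    push_cast
    nlinarith [mul_nonneg ht (sq_nonneg ‖ξ‖)]
  rw [profile, norm_mul, Complex.norm_real, mul_pow, Real.norm_eq_abs, sq_abs, mul_pow, div_pow]
  calc _ ≤ ‖moment u₁‖ ^ 2 * (Real.exp (-(t / 2) * ‖ξ‖ ^ 2) * (1 / (m ^ 2 / 2))) := by
        gcongr
    _ = _ := by field_simp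

/-- The pointwise bound for the error. The last term is present for high frequencies only. -/
lemma IsMildSolution.norm_hat_sub_profile_sq_le (hn : 1 ≤ n) {θ m : ℝ} (hθ : 0 < θ) (hθ' : θ ≤ 1)
    (hm : 0 < m) {u₁ : L2 n} (hu₁ : InWeightedL1 θ u₁) {u v : ℝ → L2 n}
    (h : IsMildSolution θ m 0 u₁ u v) {t : ℝ} (ht : 0 ≤ t) :
    ∀ᵐ ξ : Space n, disc θ m ξ ≠ 0 ∧ ‖hat (u t) ξ - profile θ m u₁ t ξ‖ ^ 2 ≤
      36 * ((m ^ 2)⁻¹ * weightedL1Norm θ u₁ ^ 2) * Real.exp (-(t / 2) * ‖ξ‖ ^ 2) +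
        if 1 < ‖ξ‖ then 2 * (‖hat u₁ ξ‖ ^ 2 * ‖kernel θ m t ξ‖ ^ 2) else 0 := by
  filter_upwards [h.hat_eq hn hθ hθ' ht, norm_hat_sub_moment_le hθ hθ' u₁ hu₁,
    ae_disc_ne_zero (m := m) hn hθ'] with ξ h1 h2 h3
  refine ⟨h3.2, ?_⟩
  have hP := norm_moment_le u₁ hu₁
  set N := weightedL1Norm θ u₁
  have hN : 0 ≤ N := weightedL1Norm_nonneg θ u₁
  split_ifs with hξ
  · have hp := norm_profile_sq_le hθ hm ht u₁ hξ.le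
    have hp' : ‖profile θ m u₁ t ξ‖ ^ 2 ≤
        2 * (m ^ 2)⁻¹ * N ^ 2 * Real.exp (-(t / 2) * ‖ξ‖ ^ 2) := hp.trans (by gcongr)
    have hpos : 0 ≤ (m ^ 2)⁻¹ * N ^ 2 * Real.exp (-(t / 2) * ‖ξ‖ ^ 2) := by positivity
    have htri : ‖hat (u t) ξ - profile θ m u₁ t ξ‖ ^ 2 ≤
        2 * ‖hat (u t) ξ‖ ^ 2 + 2 * ‖profile θ m u₁ t ξ‖ ^ 2 := by
      have := norm_sub_le (hat (u t) ξ) (profile θ m u₁ t ξ)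
      nlinarith [norm_nonneg (hat (u t) ξ - profile θ m u₁ t ξ),
        sq_nonneg (‖hat (u t) ξ‖ - ‖profile θ m u₁ t ξ‖)]
    have hk : ‖hat (u t) ξ‖ ^ 2 = ‖hat u₁ ξ‖ ^ 2 * ‖kernel θ m t ξ‖ ^ 2 := by
      rw [h1, norm_mul, mul_pow, mul_comm]
    rw [hk] at htri
    linarith
  · have hξ' : ‖ξ‖ ≤ 1 := not_lt.1 hξ
    have k1 := norm_kernel_mul_rpow_le (t := t) hθ hm ht h3.1 hξ'
    have k2 := norm_kernel_sub_le hθ hθ' hm ht h3.1 hξ'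
    set S : ℂ := ((Real.exp (-(‖ξ‖ ^ 2 / 2) * t) *
      (Real.sin (t * omega θ m ξ) / omega θ m ξ) : ℝ) : ℂ) with hS
    have e : hat (u t) ξ - profile θ m u₁ t ξ =
        kernel θ m t ξ * (hat u₁ ξ - moment u₁) + moment u₁ * (kernel θ m t ξ - S) := by
      rw [h1, profile, ← hS]
      ring
    set E := Real.exp (-(‖ξ‖ ^ 2 / 4) * t) with hE
    have key : ‖hat (u t) ξ - profile θ m u₁ t ξ‖ ≤ 6 * (m⁻¹ * N) * E := by
      rw [e]
      calc _ ≤ ‖kernel θ m t ξ‖ * ‖hat u₁ ξ - moment u₁‖ + ‖moment u₁‖ * ‖kernel θ m t ξ - S‖ := by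
            rw [← norm_mul, ← norm_mul]
            exact norm_add_le _ _
        _ ≤ ‖kernel θ m t ξ‖ * (2 * ‖ξ‖ ^ θ * N) + N * (2 * m⁻¹ * E) := by gcongr
        _ = 2 * N * (‖kernel θ m t ξ‖ * ‖ξ‖ ^ θ) + N * (2 * m⁻¹ * E) := by ring
        _ ≤ 2 * N * (2 * m⁻¹ * E) + N * (2 * m⁻¹ * E) := by gcongr
        _ = _ := by ring
    calc _ ≤ (6 * (m⁻¹ * N) * E) ^ 2 := by gcongr
      _ = 36 * ((m ^ 2)⁻¹ * N ^ 2) * E ^ 2 := by rw [mul_pow, mul_pow, mul_pow, inv_pow]; norm_num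
      _ = _ := by
        rw [hE, exp_sq_eq, add_zero]
        ring_nf

/-! ### Integration over the frequencies -/

lemma integrable_exp_neg_mul_norm_sq {b : ℝ} (hb : 0 < b) :
    Integrable (fun ξ : Space n => Real.exp (-b * ‖ξ‖ ^ 2)) := by
  have h := (GaussianFourier.integrable_cexp_neg_mul_sq_norm_add (V := Space n) (b := (b : ℂ))
    (by simpa using hb) 0 0).norm
  refine h.congr (Eventually.of_forall fun ξ => ?_)
  simp only [Complex.norm_exp]
  congr 1
  simp [← Complex.ofReal_pow]

lemma integral_exp_neg_half_mul_norm_sq {t : ℝ} (ht : 0 < t) :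
    ∫ ξ : Space n, Real.exp (-(t / 2) * ‖ξ‖ ^ 2) =
      (2 * Real.pi) ^ ((n : ℝ) / 2) * t ^ (-((n : ℝ) / 2)) := by
  rw [GaussianFourier.integral_rexp_neg_mul_sq_norm (by positivity), finrank_euclideanSpace_fin,
    Real.rpow_neg ht.le, ← div_eq_mul_inv, ← Real.div_rpow (by positivity) ht.le]
  congr 1
  field_simp

lemma integrable_norm_fourier_sq (f : L2 n) : Integrable (fun x => ‖(𝓕 f : L2 n) x‖ ^ 2) := by
  have := (Lp.memLp (𝓕 f)).integrable_norm_pow (p := 2) two_ne_zero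
  simpa using this

lemma integrable_norm_hat_sq (f : L2 n) : Integrable (fun ξ => ‖hat f ξ‖ ^ 2) :=
  (integrable_norm_fourier_sq f).comp_smul (R := (2 * Real.pi)⁻¹)
    (inv_ne_zero (by positivity))

lemma integral_norm_hat_sq (f : L2 n) :
    ∫ ξ : Space n, ‖hat f ξ‖ ^ 2 = (2 * Real.pi) ^ n * ‖f‖ ^ 2 := by
  have h1 := Measure.integral_comp_smul volume (fun x => ‖(𝓕 f : L2 n) x‖ ^ 2) (2 * Real.pi)⁻¹
  have h2 : ‖(𝓕 f : L2 n)‖ ^ 2 = ∫ x, ‖(𝓕 f : L2 n) x‖ ^ 2 := by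
    have h := L2.inner_def (𝕜 := ℂ) (𝓕 f : L2 n) (𝓕 f)
    rw [inner_self_eq_norm_sq_to_K] at h
    simp only [inner_self_eq_norm_sq_to_K] at h
    have h3 : ∫ x, (((‖(𝓕 f : L2 n) x‖ : ℝ) : ℂ)) ^ 2 = ((∫ x, ‖(𝓕 f : L2 n) x‖ ^ 2 : ℝ) : ℂ) := by
      rw [← integral_complex_ofReal]
      push_cast
      rfl
    refine Complex.ofReal_injective ?_
    rw [← h3, Complex.ofReal_pow]
    exact h
  simp only [hat]
  rw [h1, ← h2, Lp.norm_fourier_eq, finrank_euclideanSpace_fin, abs_of_nonneg (by positivity),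
    inv_pow, inv_inv, smul_eq_mul]

/-- An integrable majorant of the squared error bounds `errorSq`. -/
lemma errorSq_le_of_ae_le {θ m t : ℝ} {u₁ : L2 n} {u : ℝ → L2 n} {g : Space n → ℝ}
    (hg : Integrable g) (h : ∀ᵐ ξ, ‖hat (u t) ξ - profile θ m u₁ t ξ‖ ^ 2 ≤ g ξ) {B : ℝ}
    (hB : ∫ ξ, g ξ ≤ B) : errorSq θ m u₁ u t ≤ ENNReal.ofReal B := by
  have hg0 : 0 ≤ᵐ[volume] g := by
    filter_upwards [h] with ξ hξ
    exact (sq_nonneg _).trans hξ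
  refine le_trans ?_ (ENNReal.ofReal_le_ofReal hB)
  rw [ofReal_integral_eq_lintegral_ofReal hg hg0, errorSq]
  refine lintegral_mono_ae ?_
  filter_upwards [h] with ξ hξ
  rw [← ofReal_norm, ← ENNReal.ofReal_pow (norm_nonneg _)]
  exact ENNReal.ofReal_le_ofReal hξ

/-- The terms of `decayTerms` which dominate the error. -/
lemma le_decayTerms {θ m α β γ : ℝ} (u₁ : L2 n) (N : ℝ) {t : ℝ} (ht : 0 ≤ t) :
    (m ^ 2)⁻¹ * weightedL1Norm θ u₁ ^ 2 * t ^ (-((n : ℝ) / 2)) + N ^ 2 * t ^ 2 * Real.exp (-γ * t) ≤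
      decayTerms θ m α β γ u₁ N t := by
  have h1 : 0 ≤ (m ^ 2)⁻¹ * ‖moment u₁‖ ^ 2 * t ^ (-((n + 8 - 6 * θ) / 2)) := by positivity
  have h2 : 0 ≤ (m ^ 2)⁻¹ * ‖moment u₁‖ ^ 2 * t ^ (-((n + 4 - 4 * θ) / 2)) := by positivity
  have h3 : 0 ≤ ‖moment u₁‖ ^ 2 * Real.exp (-γ * t) := by positivity
  have h4 : 0 ≤ L1Norm u₁ ^ 2 * t ^ 2 * Real.exp (-α * t) := by positivity
  have h5 : 0 ≤ L1Norm u₁ ^ 2 * t ^ 2 * Real.exp (-β * t) := by positivity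
  rw [decayTerms]
  linarith

/-- The majorant, up to the factor `t² exp(-t/4)`, of the squared kernel for high frequencies and
`t ≥ 1`. It is integrable for `n ≤ 3`. -/
def tailMajorant (ξ : Space n) : ℝ :=
  Real.exp (-(1 / 4) * ‖ξ‖ ^ 2) + 64 * (1 + ‖ξ‖) ^ (-4 : ℝ)

lemma tailMajorant_nonneg (ξ : Space n) : 0 ≤ tailMajorant ξ := by
  unfold tailMajorant
  positivity

lemma integrable_tailMajorant (hn : n ≤ 3) : Integrable (tailMajorant : Space n → ℝ) := by
  refine (integrable_exp_neg_mul_norm_sq (by norm_num)).add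
    (Integrable.const_mul (integrable_one_add_norm ?_) _)
  rw [finrank_euclideanSpace_fin]
  have : (n : ℝ) ≤ 3 := by exact_mod_cast hn
  linarith

lemma norm_kernel_sq_le_tailMajorant {θ m t : ℝ} {ξ : Space n} (ht : 1 ≤ t) (hξ : 1 ≤ ‖ξ‖)
    (h : disc θ m ξ ≠ 0) :
    ‖kernel θ m t ξ‖ ^ 2 ≤ t ^ 2 * Real.exp (-(1 / 4) * t) * tailMajorant ξ := by
  have h1 := norm_kernel_sq_le' (by linarith : 0 ≤ t) hξ h
  have hr2 : 1 ≤ ‖ξ‖ ^ 2 := one_le_pow₀ hξ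
  have ht2 : 1 ≤ t ^ 2 := one_le_pow₀ ht
  have h2 : Real.exp (-(‖ξ‖ ^ 2 / 2) * t) ≤
      Real.exp (-(1 / 4) * t) * Real.exp (-(1 / 4) * ‖ξ‖ ^ 2) := by
    rw [← Real.exp_add]
    gcongr
    nlinarith
  have h3 : 4 * (‖ξ‖ ^ 4)⁻¹ ≤ 64 * (1 + ‖ξ‖) ^ (-4 : ℝ) := by
    have e : (1 + ‖ξ‖) ^ (-4 : ℝ) = ((1 + ‖ξ‖) ^ 4)⁻¹ := by
      rw [Real.rpow_neg (by positivity)]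
      norm_cast
    rw [e, ← div_eq_mul_inv, ← div_eq_mul_inv, div_le_div_iff₀ (by positivity) (by positivity)]
    have : (1 + ‖ξ‖) ^ 4 ≤ (2 * ‖ξ‖) ^ 4 := by
      gcongr
      linarith
    rw [mul_pow] at this
    linarith
  have h4 : Real.exp (-(2 * t)) ≤ t ^ 2 * Real.exp (-(1 / 4) * t) := by
    calc Real.exp (-(2 * t)) ≤ Real.exp (-(1 / 4) * t) := by
          gcongr
          linarith
      _ ≤ _ := le_mul_of_one_le_left (Real.exp_pos _).le ht2
  calc _ ≤ _ := h1
    _ ≤ t ^ 2 * (Real.exp (-(1 / 4) * t) * Real.exp (-(1 / 4) * ‖ξ‖ ^ 2)) +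
        64 * (1 + ‖ξ‖) ^ (-4 : ℝ) * (t ^ 2 * Real.exp (-(1 / 4) * t)) := by gcongr
    _ = _ := by
      rw [tailMajorant]
      ring

/-- The bound by the `L²` norm of the initial velocity. -/
lemma IsMildSolution.errorSq_le (hn : 1 ≤ n) {θ m : ℝ} (hθ : 0 < θ) (hθ' : θ ≤ 1) (hm : 0 < m)
    {u₁ : L2 n} (hu₁ : InWeightedL1 θ u₁) {u v : ℝ → L2 n}
    (h : IsMildSolution θ m 0 u₁ u v) {t : ℝ} (ht : 0 < t) {C α β : ℝ}
    (hC : 36 * (2 * Real.pi) ^ ((n : ℝ) / 2) ≤ C) (hC' : 2 * (2 * Real.pi) ^ n ≤ C) :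
    errorSq θ m u₁ u t ≤ ENNReal.ofReal (C * decayTerms θ m α β (1 / 4) u₁ ‖u₁‖ t) := by
  set N := weightedL1Norm θ u₁
  have hC0 : 0 ≤ C := le_trans (by positivity) hC'
  have hi1 := (integrable_exp_neg_mul_norm_sq (n := n) (half_pos ht)).const_mul
    (36 * ((m ^ 2)⁻¹ * N ^ 2))
  have hi2 := (integrable_norm_hat_sq u₁).const_mul (2 * (t ^ 2 * Real.exp (-(1 / 4) * t)))
  refine errorSq_le_of_ae_le (hi1.add hi2) ?_ ?_
  · filter_upwards [h.norm_hat_sub_profile_sq_le hn hθ hθ' hm hu₁ ht.le] with ξ hξ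
    refine hξ.2.trans ?_
    simp only [Pi.add_apply]
    gcongr
    split_ifs with h1
    · have hk := norm_kernel_sq_le ht.le h1.le hξ.1
      have hk' : ‖kernel θ m t ξ‖ ^ 2 ≤ t ^ 2 * Real.exp (-(1 / 4) * t) := by
        refine hk.trans ?_
        gcongr
        linarith
      calc _ ≤ 2 * (‖hat u₁ ξ‖ ^ 2 * (t ^ 2 * Real.exp (-(1 / 4) * t))) := by gcongr
        _ = _ := by ring
    · positivity
  · rw [integral_add' hi1 hi2, integral_const_mul, integral_const_mul,
      integral_exp_neg_half_mul_norm_sq ht, integral_norm_hat_sq]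
    refine le_trans ?_ (mul_le_mul_of_nonneg_left (le_decayTerms u₁ ‖u₁‖ ht.le) hC0)
    calc _ = 36 * (2 * Real.pi) ^ ((n : ℝ) / 2) * ((m ^ 2)⁻¹ * N ^ 2 * t ^ (-((n : ℝ) / 2))) +
          2 * (2 * Real.pi) ^ n * (‖u₁‖ ^ 2 * t ^ 2 * Real.exp (-(1 / 4) * t)) := by ring
      _ ≤ C * ((m ^ 2)⁻¹ * N ^ 2 * t ^ (-((n : ℝ) / 2))) +
          C * (‖u₁‖ ^ 2 * t ^ 2 * Real.exp (-(1 / 4) * t)) := by gcongr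
      _ = _ := by ring

/-- The bound by the `L¹` norm of the initial velocity, in low dimensions. -/
lemma IsMildSolution.errorSq_le_of_le_three (hn : 1 ≤ n) (hn' : n ≤ 3) {θ m : ℝ} (hθ : 0 < θ)
    (hθ' : θ ≤ 1) (hm : 0 < m) {u₁ : L2 n} (hu₁ : InWeightedL1 θ u₁) {u v : ℝ → L2 n}
    (h : IsMildSolution θ m 0 u₁ u v) {t : ℝ} (ht : 1 ≤ t) {C α β : ℝ}
    (hC : 36 * (2 * Real.pi) ^ ((n : ℝ) / 2) ≤ C)
    (hC' : 2 * (∫ ξ : Space n, tailMajorant ξ) ≤ C) :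
    errorSq θ m u₁ u t ≤ ENNReal.ofReal (C * decayTerms θ m α β (1 / 4) u₁ (L1Norm u₁) t) := by
  set N := weightedL1Norm θ u₁
  have ht0 : 0 < t := by linarith
  have hC0 : 0 ≤ C := le_trans (by positivity) hC
  have hi1 := (integrable_exp_neg_mul_norm_sq (n := n) (half_pos ht0)).const_mul
    (36 * ((m ^ 2)⁻¹ * N ^ 2))
  have hi2 := (integrable_tailMajorant hn').const_mul
    (2 * (L1Norm u₁ ^ 2 * t ^ 2 * Real.exp (-(1 / 4) * t)))
  refine errorSq_le_of_ae_le (hi1.add hi2) ?_ ?_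
  · filter_upwards [h.norm_hat_sub_profile_sq_le hn hθ hθ' hm hu₁ ht0.le,
      norm_hat_le u₁ hu₁.1] with ξ hξ hL
    refine hξ.2.trans ?_
    simp only [Pi.add_apply]
    gcongr
    have := tailMajorant_nonneg ξ
    split_ifs with h1
    · have hk := norm_kernel_sq_le_tailMajorant ht h1.le hξ.1
      calc _ ≤ 2 * (L1Norm u₁ ^ 2 * (t ^ 2 * Real.exp (-(1 / 4) * t) * tailMajorant ξ)) := by gcongr
        _ = _ := by ring
    · positivity
  · rw [integral_add' hi1 hi2, integral_const_mul, integral_const_mul,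
      integral_exp_neg_half_mul_norm_sq ht0]
    refine le_trans ?_ (mul_le_mul_of_nonneg_left (le_decayTerms u₁ (L1Norm u₁) ht0.le) hC0)
    calc _ = 36 * (2 * Real.pi) ^ ((n : ℝ) / 2) * ((m ^ 2)⁻¹ * N ^ 2 * t ^ (-((n : ℝ) / 2))) +
          2 * (∫ ξ : Space n, tailMajorant ξ) *
            (L1Norm u₁ ^ 2 * t ^ 2 * Real.exp (-(1 / 4) * t)) := by ring
      _ ≤ C * ((m ^ 2)⁻¹ * N ^ 2 * t ^ (-((n : ℝ) / 2))) +
          C * (L1Norm u₁ ^ 2 * t ^ 2 * Real.exp (-(1 / 4) * t)) := by gcongr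
      _ = _ := by ring

end LogWave
end

theorem theorem1p1 (n : ℕ) (hn : 1 ≤ n) (θ : ℝ) (hθ : 0 < θ) (hθ' : θ ≤ 1) :
    ∃ C α β γ : ℝ, 0 < C ∧ 0 < α ∧ 0 < β ∧ 0 < γ ∧
      ∀ (m : ℝ), 0 < m → ∀ (u₁ : LogWave.L2 n), LogWave.InWeightedL1 θ u₁ →
        ∀ (u v : ℝ → LogWave.L2 n), LogWave.IsMildSolution θ m 0 u₁ u v →
          (∀ t : ℝ, 0 < t →
            LogWave.errorSq θ m u₁ u t ≤
              ENNReal.ofReal (C * LogWave.decayTerms θ m α β γ u₁ ‖u₁‖ t)) ∧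
          (n ≤ 3 → ∀ t : ℝ, 1 ≤ t →
            LogWave.errorSq θ m u₁ u t ≤
              ENNReal.ofReal
                (C * LogWave.decayTerms θ m α β γ u₁ (LogWave.L1Norm u₁) t)) := by
  have h1 : 0 < 36 * (2 * Real.pi) ^ ((n : ℝ) / 2) := by positivity
  have h2 : 0 < 2 * (2 * Real.pi) ^ n := by positivity
  have h3 : 0 ≤ 2 * ∫ ξ : LogWave.Space n, LogWave.tailMajorant ξ :=
    mul_nonneg zero_le_two (MeasureTheory.integral_nonneg LogWave.tailMajorant_nonneg)
  refine ⟨36 * (2 * Real.pi) ^ ((n : ℝ) / 2) + 2 * (2 * Real.pi) ^ n +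
    2 * ∫ ξ : LogWave.Space n, LogWave.tailMajorant ξ, 1, 1, 1 / 4, by linarith, one_pos, one_pos,
    by norm_num, fun m hm u₁ hu₁ u v h => ⟨fun t ht => ?_, fun hn' t ht => ?_⟩⟩
  · exact h.errorSq_le hn hθ hθ' hm hu₁ ht (by linarith) (by linarith)
  · exact h.errorSq_le_of_le_three hn hn' hθ hθ' hm hu₁ ht (by linarith) (by linarith)
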